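/- **Notation.** Let $sl_2$ have generators $e,f,h$ with $[h,e]=e$, $[h,f]=-f$, $[e,f]=2h$. For $\lambda\in\mathbb C$ let $V_\lambda=\bigoplus_{i\ge 0}\mathbb C f^iv_\lambda$ be the Verma module with highest weight $\lambda$ and highest weight vector $v_\lambda$. Let $\Lambda^+=\{0,\tfrac12,1,\tfrac32,\dots\}$. Put $S_\lambda=\bigoplus_{i\ge 2\lambda+1}\mathbb C f^iv_\lambda$ if $\lambda\in\Lambda^+$ and $S_\lambda=0$ otherwise, so that $L_\lambda=V_\lambda/S_\lambda$ is the irreducible module with highest weight $\lambda$. Let $Y(sl_2)$ be the Yangian, generated by elements $a$, $J(a)$ ($a\in sl_2$), linear in $a$, with relations $ab-ba=[a,b]$, $aJ(b)-J(b)a=J([a,b])$, $[[J(e),J(f)],J(h)]=(J(e)f-eJ(f))h$, with comultiplication $\Delta(a)=a\otimes1+1\otimes a$, $\Delta(J(a))=J(a)\otimes1+1\otimes J(a)+\tfrac12[1\otimes a,\Omega]$, where $\Omega=e\otimes f+f\otimes e+2h\otimes h$, and evaluation homomorphisms $Y(sl_2)\to U(sl_2)$, $a\mapsto a$, $J(a)\mapsto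 xa$. An $sl_2$-module $M$ pulled back along the latter is the Yangian module $M(x)$. For irreducible highest weight modules $L_{\lambda_1},L_{\lambda_2}$ with highest weight vectors $v_1,v_2$, the rational $R$-matrix $R_{L_{\lambda_1}L_{\lambda_2}}(x)\in\operatorname{End}(L_{\lambda_1}\otimes L_{\lambda_2})$ is the unique operator $R$ fixing $v_1\otimes v_2$ such that $PR$ is a homomorphism of Yangian modules $L_{\lambda_1}(z)\otimes L_{\lambda_2}(w)\to L_{\lambda_2}(w)\otimes L_{\lambda_1}(z)$ whenever $z-w=x$, where $P$ is the permutation of factors. For $\lambda_1,\lambda_2\notin\Lambda^+$ we have $V_{\lambda_i}=L_{\lambda_i}$, which defines $R_{V_{\lambda_1}V_{\lambda_2}}(x)$. The spaces $V_{\lambda_1}\otimes V_{\lambda_2}$ for different $\lambda_1,\lambda_2$ are identified by the bases $\{f^iv_{\lambda_1}\otimes f^jv_{\lambda_2}\}$ with one space $V\otimes V$; a function with values in $\operatorname{End}(V\otimes V)$ is meromorphic or holomorphic if all its matrix entries are. Call $(x,\lambda_1,\lambda_2)\in\mathbb C^3$ generic if $x-\lambda_1-\lambda_2+s\ne0$ for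 all $s\in\mathbb Z_{\ge0}$. **Theorem.** There is a family of operators $R_{V_{\lambda_1}V_{\lambda_2}}(x)\in\operatorname{End}(V_{\lambda_1}\otimes V_{\lambda_2})$, $x,\lambda_1,\lambda_2\in\mathbb C$, such that for $\lambda_1,\lambda_2\notin\Lambda^+$ and $(x,\lambda_1,\lambda_2)$ generic the rational $R$-matrix of $V_{\lambda_1},V_{\lambda_2}$ defined above exists, is unique, and equals $R_{V_{\lambda_1}V_{\lambda_2}}(x)$, and such that: 1. $R_{V_{\lambda_1}V_{\lambda_2}}(x)$ is a meromorphic function of $(x,\lambda_1,\lambda_2)\in\mathbb C^3$, holomorphic at every generic point; that is, its poles lie on the hyperplanes $x-\lambda_1-\lambda_2+s=0$, $s\in\mathbb Z_{\ge0}$. 2. For all $\lambda_1,\lambda_2\in\mathbb C$ and all $x$ with $(x,\lambda_1,\lambda_2)$ generic, $R_{V_{\lambda_1}V_{\lambda_2}}(x)$ preserves $S_{\lambda_1}\otimes V_{\lambda_2}+V_{\lambda_1}\otimes S_{\lambda_2}$. 3. For all $\lambda_1,\lambda_2\in\mathbb C$ and all $x$ with $(x,\lambda_1,\lambda_2)$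 generic, $R_{V_{\lambda_1}V_{\lambda_2}}(x)$ descends along the canonical map $V_{\lambda_1}\otimes V_{\lambda_2}\to L_{\lambda_1}\otimes L_{\lambda_2}$ to an operator $R(x)\in\operatorname{End}(L_{\lambda_1}\otimes L_{\lambda_2})$; moreover the rational $R$-matrix $R_{L_{\lambda_1}L_{\lambda_2}}(x)$ exists, is unique, and $R(x)=R_{L_{\lambda_1}L_{\lambda_2}}(x)$. -/

import Mathlib

open scoped TensorProduct

noncomputable section

namespace RationalR

attribute [local instance 100] LieRing.ofAssociativeRing

/-! ### The Lie algebra `sl₂`, with `[h,e] = e`, `[h,f] = -f`, `[e,f] = 2h` -/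

/-- The complex Lie algebra `sl₂` of traceless `2 × 2` matrices. -/
abbrev Sl2 : Type := LieAlgebra.SpecialLinear.sl (Fin 2) ℂ

/-- The generator `e` of `sl₂`. -/
def e : Sl2 := ⟨!![0, 1; 0, 0], by simp [LieAlgebra.SpecialLinear.sl, Matrix.trace_fin_two]⟩

/-- The generator `f` of `sl₂`. -/
def f : Sl2 := ⟨!![0, 0; 1, 0], by simp [LieAlgebra.SpecialLinear.sl, Matrix.trace_fin_two]⟩

/-- The generator `h` of `sl₂` (one half of the usual coroot). -/
def h : Sl2 := ⟨!![1 / 2, 0; 0, -1 / 2], by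
  norm_num [LieAlgebra.SpecialLinear.sl, Matrix.trace_fin_two]⟩

theorem lie_h_e : ⁅h, e⁆ = e := by
  apply Subtype.ext
  rw [LieAlgebra.SpecialLinear.sl_bracket]
  ext i j; fin_cases i <;> fin_cases j <;> norm_num [h, e, Matrix.mul_apply, Fin.sum_univ_two]

theorem lie_h_f : ⁅h, f⁆ = -f := by
  apply Subtype.ext
  rw [LieAlgebra.SpecialLinear.sl_bracket]
  ext i j; fin_cases i <;> fin_cases j <;> norm_num [h, f, Matrix.mul_apply, Fin.sum_univ_two]

theorem lie_e_f : ⁅e, f⁆ = (2 : ℂ) • h := by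
  apply Subtype.ext
  rw [LieAlgebra.SpecialLinear.sl_bracket]
  ext i j; fin_cases i <;> fin_cases j <;> norm_num [h, f, e, Matrix.mul_apply, Fin.sum_univ_two]

theorem sl2_trace (A : Sl2) : A.1 1 1 = -A.1 0 0 := by
  have h2 : Matrix.trace A.1 = 0 := A.2
  rw [Matrix.trace_fin_two] at h2
  linear_combination h2

/-- `e, f, h` span `sl₂`. -/
theorem sl2_decomp (A : Sl2) :
    A = A.1 0 1 • e + A.1 1 0 • f + (2 * A.1 0 0) • h := by
  apply Subtype.ext
  ext i j
  fin_cases i <;> fin_cases j <;> simp [e, f, h, sl2_trace A] <;> ring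

/-! ### Verma modules -/

/-- The underlying space of the Verma module `V_lam`; the basis vector `single i 1` is `f ^ i v`. -/
def Verma (_lam : ℂ) : Type := ℕ →₀ ℂ

instance (lam : ℂ) : AddCommGroup (Verma lam) := inferInstanceAs (AddCommGroup (ℕ →₀ ℂ))
instance (lam : ℂ) : Module ℂ (Verma lam) := inferInstanceAs (Module ℂ (ℕ →₀ ℂ))

/-- The distinguished basis `i ↦ f ^ i v` of `V_lam`. -/
def vermaBasis (lam : ℂ) : Module.Basis ℕ ℂ (Verma lam) := Module.Basis.ofRepr (LinearEquiv.refl ℂ (ℕ →₀ ℂ))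

/-- `e (f ^ i v) = i (2 lam - i + 1) f ^ (i - 1) v`. -/
def vermaE (lam : ℂ) : Module.End ℂ (Verma lam) :=
  (vermaBasis lam).constr ℂ fun i => ((i : ℂ) * (2 * lam - i + 1)) • vermaBasis lam (i - 1)

/-- `f (f ^ i v) = f ^ (i + 1) v`. -/
def vermaF (lam : ℂ) : Module.End ℂ (Verma lam) :=
  (vermaBasis lam).constr ℂ fun i => vermaBasis lam (i + 1)

/-- `h (f ^ i v) = (lam - i) f ^ i v`. -/
def vermaH (lam : ℂ) : Module.End ℂ (Verma lam) :=
  (vermaBasis lam).constr ℂ fun i => (lam - i) • vermaBasis lam i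

@[simp] theorem vermaE_basis (lam : ℂ) (i : ℕ) : vermaE lam (vermaBasis lam i) =
    ((i : ℂ) * (2 * lam - i + 1)) • vermaBasis lam (i - 1) := by
  simp [vermaE, Module.Basis.constr_basis]

@[simp] theorem vermaF_basis (lam : ℂ) (i : ℕ) :
    vermaF lam (vermaBasis lam i) = vermaBasis lam (i + 1) := by
  simp [vermaF, Module.Basis.constr_basis]

@[simp] theorem vermaH_basis (lam : ℂ) (i : ℕ) :
    vermaH lam (vermaBasis lam i) = (lam - i) • vermaBasis lam i := by
  simp [vermaH, Module.Basis.constr_basis]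

theorem verma_he (lam : ℂ) : ⁅vermaH lam, vermaE lam⁆ = vermaE lam := by
  apply (vermaBasis lam).ext
  intro i
  rcases i with _ | i
  · simp [Ring.lie_def]
  · simp only [Ring.lie_def, LinearMap.sub_apply, Module.End.mul_apply, vermaE_basis, vermaH_basis,
      map_smul, Nat.add_sub_cancel, Nat.cast_add, Nat.cast_one]
    module

theorem verma_hf (lam : ℂ) : ⁅vermaH lam, vermaF lam⁆ = -vermaF lam := by
  apply (vermaBasis lam).ext
  intro i
  simp only [Ring.lie_def, LinearMap.sub_apply, Module.End.mul_apply, vermaF_basis, vermaH_basis,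
      map_smul, LinearMap.neg_apply, Nat.cast_add, Nat.cast_one]
  module

theorem verma_ef (lam : ℂ) : ⁅vermaE lam, vermaF lam⁆ = (2 : ℂ) • vermaH lam := by
  apply (vermaBasis lam).ext
  intro i
  rcases i with _ | i
  · simp [Ring.lie_def, mul_smul, two_smul]
  · simp only [Ring.lie_def, LinearMap.sub_apply, Module.End.mul_apply, vermaE_basis, vermaH_basis,
      vermaF_basis, LinearMap.smul_apply,
      map_smul, Nat.add_sub_cancel, Nat.cast_add, Nat.cast_one]
    module

/-- The linear map `sl₂ → End V_lam` with `e, f, h` acting by `vermaE, vermaF, vermaH`. -/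
def vermaLin (lam : ℂ) (A : Sl2) : Module.End ℂ (Verma lam) :=
  A.1 0 1 • vermaE lam + A.1 1 0 • vermaF lam + (2 * A.1 0 0) • vermaH lam

/-- The action of `sl₂` on the Verma module `V_lam`. -/
def vermaHom (lam : ℂ) : Sl2 →ₗ⁅ℂ⁆ Module.End ℂ (Verma lam) where
  toFun := vermaLin lam
  map_add' A B := by
    have hAB : (A + B).1 = A.1 + B.1 := rfl
    simp only [vermaLin, hAB, Matrix.add_apply]
    module
  map_smul' c A := by
    have hA : (c • A).1 = c • A.1 := rfl
    simp only [vermaLin, hA, Matrix.smul_apply, RingHom.id_apply, smul_eq_mul]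
    module
  map_lie' := by
    intro A B
    have heh : ⁅vermaE lam, vermaH lam⁆ = -vermaE lam := by rw [← lie_skew, verma_he]
    have hfh : ⁅vermaF lam, vermaH lam⁆ = vermaF lam := by rw [← lie_skew, verma_hf, neg_neg]
    have hfe : ⁅vermaF lam, vermaE lam⁆ = -((2 : ℂ) • vermaH lam) := by
      rw [← lie_skew, verma_ef]
    simp only [vermaLin, LieAlgebra.SpecialLinear.sl_bracket, Matrix.sub_apply, Matrix.mul_apply,
      Fin.sum_univ_two, sl2_trace A, sl2_trace B, lie_add, add_lie, lie_smul, smul_lie, lie_self,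
      verma_he, verma_hf, verma_ef, heh, hfh, hfe]
    module

instance (lam : ℂ) : LieRingModule Sl2 (Verma lam) :=
  LieRingModule.compLieHom (Verma lam) (vermaHom lam)

instance (lam : ℂ) : LieModule ℂ Sl2 (Verma lam) :=
  LieModule.compLieHom (Verma lam) (vermaHom lam)

theorem verma_lie (lam : ℂ) (A : Sl2) (m : Verma lam) : ⁅A, m⁆ =
    A.1 0 1 • vermaE lam m + A.1 1 0 • vermaF lam m + (2 * A.1 0 0) • vermaH lam m := rfl

/-- The highest weight vector of `V_lam`. -/
def vermaTop (lam : ℂ) : Verma lam := vermaBasis lam 0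

/-- The set of dominant weights `{0, 1/2, 1, 3/2, …}`. -/
def IsDominant (lam : ℂ) : Prop := ∃ n : ℕ, 2 * lam = n

/-- The submodule `S_lam` of `V_lam`: the span of the `f ^ i v` with `i ≥ 2 lam + 1` when `lam` is
dominant, and zero otherwise. -/
def vermaS (lam : ℂ) : LieSubmodule ℂ Sl2 (Verma lam) where
  __ := Submodule.span ℂ {w | ∃ n i : ℕ, 2 * lam = n ∧ n + 1 ≤ i ∧ w = vermaBasis lam i}
  lie_mem := by
    intro A m hm
    change m ∈ Submodule.span ℂ _ at hm
    change ⁅A, m⁆ ∈ Submodule.span ℂ _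
    induction hm using Submodule.span_induction with
    | mem w hw =>
      obtain ⟨n, i, hn, hi, rfl⟩ := hw
      rw [verma_lie]
      have key : ∀ j, n + 1 ≤ j → vermaBasis lam j ∈ Submodule.span ℂ
          {w | ∃ n i : ℕ, 2 * lam = n ∧ n + 1 ≤ i ∧ w = vermaBasis lam i} :=
        fun j hj => Submodule.subset_span ⟨n, j, hn, hj, rfl⟩
      refine add_mem (add_mem ?_ ?_) ?_
      · refine Submodule.smul_mem _ _ ?_
        rw [vermaE_basis]
        rcases Nat.lt_or_ge (n + 1) i with h' | h'
        · exact Submodule.smul_mem _ _ (key _ (by omega))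
        · obtain rfl : i = n + 1 := by omega
          rw [hn]
          simp
      · refine Submodule.smul_mem _ _ ?_
        rw [vermaF_basis]
        exact key _ (by omega)
      · refine Submodule.smul_mem _ _ ?_
        rw [vermaH_basis]
        exact Submodule.smul_mem _ _ (key _ hi)
    | zero => simp
    | add x y _ _ hx hy => rw [lie_add]; exact add_mem hx hy
    | smul c x _ hx => rw [lie_smul]; exact Submodule.smul_mem _ _ hx

/-- The irreducible highest weight module `L_lam = V_lam / S_lam`. -/
abbrev Irr (lam : ℂ) : Type := Verma lam ⧸ vermaS lam

/-- The canonical projection `V_lam → L_lam`. -/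
def toIrr (lam : ℂ) : Verma lam →ₗ[ℂ] Irr lam :=
  (LieSubmodule.Quotient.mk' (vermaS lam) : Verma lam →ₗ[ℂ] Irr lam)

/-- The highest weight vector of `L_lam`. -/
def irrTop (lam : ℂ) : Irr lam := toIrr lam (vermaTop lam)

/-- `S_{lam₁} ⊗ V_{lam₂} + V_{lam₁} ⊗ S_{lam₂}` as a subspace of `V_{lam₁} ⊗ V_{lam₂}`. -/
def tensorS (lam₁ lam₂ : ℂ) : Submodule ℂ (Verma lam₁ ⊗[ℂ] Verma lam₂) :=
  LinearMap.range (TensorProduct.map (vermaS lam₁ : Submodule ℂ (Verma lam₁)).subtype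
      (LinearMap.id : Verma lam₂ →ₗ[ℂ] Verma lam₂)) ⊔
    LinearMap.range (TensorProduct.map (LinearMap.id : Verma lam₁ →ₗ[ℂ] Verma lam₁)
      (vermaS lam₂ : Submodule ℂ (Verma lam₂)).subtype)

/-! ### The Yangian `Y(sl₂)`

Drinfeld's first presentation: generators `a`, `J(a)`, linear in `a ∈ sl₂`, with
`[a, b] = [a, b]_{sl₂}`, `[a, J(b)] = J([a, b])` and `[[J(e), J(f)], J(h)] = (J(e) f - e J(f)) h`. -/

/-- The free algebra on the symbols `a` and `J(a)`, `a ∈ sl₂`. -/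
abbrev PreYangian : Type := FreeAlgebra ℂ (Sl2 ⊕ Sl2)

namespace PreYangian

/-- The symbol `a`. -/
def gen (a : Sl2) : PreYangian := FreeAlgebra.ι ℂ (Sum.inl a)

/-- The symbol `J(a)`. -/
def J (a : Sl2) : PreYangian := FreeAlgebra.ι ℂ (Sum.inr a)

/-- The defining relations of the Yangian. -/
inductive Rel : PreYangian → PreYangian → Prop
  | gen_add (a b : Sl2) : Rel (gen (a + b)) (gen a + gen b)
  | gen_smul (c : ℂ) (a : Sl2) : Rel (gen (c • a)) (c • gen a)
  | J_add (a b : Sl2) : Rel (J (a + b)) (J a + J b)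
  | J_smul (c : ℂ) (a : Sl2) : Rel (J (c • a)) (c • J a)
  | gen_gen (a b : Sl2) : Rel (gen a * gen b - gen b * gen a) (gen ⁅a, b⁆)
  | gen_J (a b : Sl2) : Rel (gen a * J b - J b * gen a) (J ⁅a, b⁆)
  | J_J_J : Rel
      ((J e * J f - J f * J e) * J h - J h * (J e * J f - J f * J e))
      ((J e * gen f - gen e * J f) * gen h)

end PreYangian

/-- The Yangian `Y(sl₂)`. -/
def Yangian : Type := RingQuot PreYangian.Rel

instance : Ring Yangian := inferInstanceAs (Ring (RingQuot PreYangian.Rel))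

instance : Algebra ℂ Yangian := inferInstanceAs (Algebra ℂ (RingQuot PreYangian.Rel))

namespace Yangian

/-- The quotient map from the free algebra. -/
def mk : PreYangian →ₐ[ℂ] Yangian := RingQuot.mkAlgHom ℂ PreYangian.Rel

theorem mk_rel {x y : PreYangian} (hxy : PreYangian.Rel x y) : mk x = mk y :=
  RingQuot.mkAlgHom_rel ℂ hxy

/-- The generator `a` of the Yangian. -/
def gen : Sl2 →ₗ[ℂ] Yangian where
  toFun a := mk (PreYangian.gen a)
  map_add' a b := by
    rw [mk_rel (PreYangian.Rel.gen_add a b), map_add]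
  map_smul' c a := by
    rw [mk_rel (PreYangian.Rel.gen_smul c a), map_smul, RingHom.id_apply]

/-- The generator `J(a)` of the Yangian. -/
def J : Sl2 →ₗ[ℂ] Yangian where
  toFun a := mk (PreYangian.J a)
  map_add' a b := by
    rw [mk_rel (PreYangian.Rel.J_add a b), map_add]
  map_smul' c a := by
    rw [mk_rel (PreYangian.Rel.J_smul c a), map_smul, RingHom.id_apply]

set_option linter.unusedSimpArgs false

theorem gen_gen (a b : Sl2) : gen a * gen b - gen b * gen a = gen ⁅a, b⁆ := by
  simpa [gen] using mk_rel (PreYangian.Rel.gen_gen a b)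

theorem gen_J (a b : Sl2) : gen a * J b - J b * gen a = J ⁅a, b⁆ := by
  simpa [gen, J] using mk_rel (PreYangian.Rel.gen_J a b)

theorem J_J_J : (J e * J f - J f * J e) * J h - J h * (J e * J f - J f * J e) =
    (J e * gen f - gen e * J f) * gen h := by
  simpa [gen, J] using mk_rel PreYangian.Rel.J_J_J

/-- The universal property: an algebra map out of the Yangian is given by the images of the
generators, subject to the defining relations. -/
def lift {A : Type*} [Ring A] [Algebra ℂ A] (g j : Sl2 →ₗ[ℂ] A)
    (h₁ : ∀ a b, g a * g b - g b * g a = g ⁅a, b⁆)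
    (h₂ : ∀ a b, g a * j b - j b * g a = j ⁅a, b⁆)
    (h₃ : (j e * j f - j f * j e) * j h - j h * (j e * j f - j f * j e) =
      (j e * g f - g e * j f) * g h) : Yangian →ₐ[ℂ] A :=
  RingQuot.liftAlgHom ℂ ⟨FreeAlgebra.lift ℂ (Sum.elim g j), by
    intro x y hxy
    cases hxy <;> simp [PreYangian.gen, PreYangian.J, h₁, h₂, h₃]⟩

theorem lift_mk {A : Type*} [Ring A] [Algebra ℂ A] (g j : Sl2 →ₗ[ℂ] A) (h₁ h₂ h₃)
    (y : PreYangian) : lift g j h₁ h₂ h₃ (mk y) = FreeAlgebra.lift ℂ (Sum.elim g j) y :=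
  RingQuot.liftAlgHom_mkAlgHom_apply ℂ _ _ y

theorem lift_gen {A : Type*} [Ring A] [Algebra ℂ A] (g j : Sl2 →ₗ[ℂ] A) (h₁ h₂ h₃) (a : Sl2) :
    lift g j h₁ h₂ h₃ (gen a) = g a := by
  rw [gen, LinearMap.coe_mk, AddHom.coe_mk, lift_mk]
  simp [PreYangian.gen]

theorem lift_J {A : Type*} [Ring A] [Algebra ℂ A] (g j : Sl2 →ₗ[ℂ] A) (h₁ h₂ h₃) (a : Sl2) :
    lift g j h₁ h₂ h₃ (J a) = j a := by
  rw [J, LinearMap.coe_mk, AddHom.coe_mk, lift_mk]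
  simp [PreYangian.J]

set_option maxHeartbeats 4000000 in
/-- The cubic relation is preserved by the comultiplication, in terms of commuting copies of the
generators. -/
theorem cubic {A : Type*} [Ring A] [Algebra ℂ A]
    (e1 f1 h1 E1 F1 H1 e2 f2 h2 E2 F2 H2 : A)
    (he1 : h1 * e1 = e1 * h1 + e1) (hf1 : h1 * f1 = f1 * h1 - f1) (ef1 : e1 * f1 = f1 * e1 + (2:ℂ) • h1)
    (hE1 : h1 * E1 = E1 * h1 + E1) (hF1 : h1 * F1 = F1 * h1 - F1) (hH1 : h1 * H1 = H1 * h1)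
    (eE1 : e1 * E1 = E1 * e1) (eF1 : e1 * F1 = F1 * e1 + (2:ℂ) • H1) (eH1 : e1 * H1 = H1 * e1 - E1)
    (fE1 : f1 * E1 = E1 * f1 - (2:ℂ) • H1) (fF1 : f1 * F1 = F1 * f1) (fH1 : f1 * H1 = H1 * f1 + F1)
    (he2 : h2 * e2 = e2 * h2 + e2) (hf2 : h2 * f2 = f2 * h2 - f2) (ef2 : e2 * f2 = f2 * e2 + (2:ℂ) • h2)
    (hE2 : h2 * E2 = E2 * h2 + E2) (hF2 : h2 * F2 = F2 * h2 - F2) (hH2 : h2 * H2 = H2 * h2)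
    (eE2 : e2 * E2 = E2 * e2) (eF2 : e2 * F2 = F2 * e2 + (2:ℂ) • H2) (eH2 : e2 * H2 = H2 * e2 - E2)
    (fE2 : f2 * E2 = E2 * f2 - (2:ℂ) • H2) (fF2 : f2 * F2 = F2 * f2) (fH2 : f2 * H2 = H2 * f2 + F2)
    (c1 : E1 * F1 * H1 - F1 * E1 * H1 - H1 * E1 * F1 + H1 * F1 * E1 = E1 * f1 * h1 - e1 * F1 * h1)
    (c2 : E2 * F2 * H2 - F2 * E2 * H2 - H2 * E2 * F2 + H2 * F2 * E2 = E2 * f2 * h2 - e2 * F2 * h2)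
    (comm : ∀ x ∈ [e1, f1, h1, E1, F1, H1], ∀ y ∈ [e2, f2, h2, E2, F2, H2], y * x = x * y)
    (E F H : A) (hE : E = E1 + E2 + e1 * h2 - h1 * e2) (hF : F = F1 + F2 + h1 * f2 - f1 * h2)
    (hH : H = H1 + H2 + (1/2 : ℂ) • (f1 * e2 - e1 * f2)) :
    (E * F - F * E) * H - H * (E * F - F * E) = (E * (f1 + f2) - (e1 + e2) * F) * (h1 + h2) := by
  have as : ∀ {a b c : A}, a * b = c → ∀ z, a * (b * z) = c * z := by
    intro a b c h z; rw [← mul_assoc, h]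
  simp only [List.mem_cons, List.not_mem_nil, or_false, forall_eq_or_imp, forall_eq] at comm
  obtain ⟨⟨a1, a2, a3, a4, a5, a6⟩, ⟨b1, b2, b3, b4, b5, b6⟩, ⟨d1, d2, d3, d4, d5, d6⟩,
    ⟨g1, g2, g3, g4, g5, g6⟩, ⟨i1, i2, i3, i4, i5, i6⟩, ⟨j1, j2, j3, j4, j5, j6⟩⟩ := comm
  have c1' : E1 * (F1 * H1) = F1 * (E1 * H1) + H1 * (E1 * F1) - H1 * (F1 * E1) + E1 * (f1 * h1) - e1 * (F1 * h1) := by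
    simp only [mul_assoc] at c1
    linear_combination (norm := module) c1
  have c2' : E2 * (F2 * H2) = F2 * (E2 * H2) + H2 * (E2 * F2) - H2 * (F2 * E2) + E2 * (f2 * h2) - e2 * (F2 * h2) := by
    simp only [mul_assoc] at c2
    linear_combination (norm := module) c2
  have hEF : E * F - F * E = (E1 * F1 - F1 * E1) + (E2 * F2 - F2 * E2) - E1 * f2 + f1 * E2 -
      e1 * F2 + F1 * e2 - (e1 * h1 * f2 + e1 * f2 * h2 + f1 * h1 * e2 + f1 * e2 * h2) -
      (2 : ℂ) • (h1 * h2 * h2 + h1 * h1 * h2) := by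
    subst hE hF
    simp only [mul_add, add_mul, mul_sub, sub_mul, mul_assoc, smul_mul_assoc, mul_smul_comm, smul_add, smul_sub,
      he1, hf1, ef1, hE1, hF1, hH1, eE1, eF1, eH1, fE1, fF1, fH1, 
      he2, hf2, ef2, hE2, hF2, hH2, eE2, eF2, eH2, fE2, fF2, fH2, 
      as he1, as hf1, as ef1, as hE1, as hF1, as hH1, as eE1, as eF1, as eH1, as fE1, as fF1, as fH1, 
      as he2, as hf2, as ef2, as hE2, as hF2, as hH2, as eE2, as eF2, as eH2, as fE2, as fF2, as fH2, 
      a1, a2, a3, a4, a5, a6, b1, b2, b3, b4, b5, b6, d1, d2, d3, d4, d5, d6,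
      g1, g2, g3, g4, g5, g6, i1, i2, i3, i4, i5, i6, j1, j2, j3, j4, j5, j6,
      as a1, as a2, as a3, as a4, as a5, as a6, as b1, as b2, as b3, as b4, as b5, as b6,
      as d1, as d2, as d3, as d4, as d5, as d6, as g1, as g2, as g3, as g4, as g5, as g6,
      as i1, as i2, as i3, as i4, as i5, as i6, as j1, as j2, as j3, as j4, as j5, as j6]
    module
  rw [hEF]
  subst hE hF hH
  simp only [mul_add, add_mul, mul_sub, sub_mul, mul_assoc, smul_mul_assoc, mul_smul_comm, smul_add, smul_sub,
    he1, hf1, ef1, hE1, hF1, hH1, eE1, eF1, eH1, fE1, fF1, fH1, 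
    he2, hf2, ef2, hE2, hF2, hH2, eE2, eF2, eH2, fE2, fF2, fH2, 
    as he1, as hf1, as ef1, as hE1, as hF1, as hH1, as eE1, as eF1, as eH1, as fE1, as fF1, as fH1, 
    as he2, as hf2, as ef2, as hE2, as hF2, as hH2, as eE2, as eF2, as eH2, as fE2, as fF2, as fH2, 
    a1, a2, a3, a4, a5, a6, b1, b2, b3, b4, b5, b6, d1, d2, d3, d4, d5, d6,
    g1, g2, g3, g4, g5, g6, i1, i2, i3, i4, i5, i6, j1, j2, j3, j4, j5, j6,
    as a1, as a2, as a3, as a4, as a5, as a6, as b1, as b2, as b3, as b4, as b5, as b6,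
    as d1, as d2, as d3, as d4, as d5, as d6, as g1, as g2, as g3, as g4, as g5, as g6,
    as i1, as i2, as i3, as i4, as i5, as i6, as j1, as j2, as j3, as j4, as j5, as j6,
    c1', c2']
  module

/-- The evaluation homomorphism `Y(sl₂) → U(sl₂)`, `a ↦ a`, `J(a) ↦ x a`. -/
def eval (x : ℂ) : Yangian →ₐ[ℂ] UniversalEnvelopingAlgebra ℂ Sl2 :=
  lift (UniversalEnvelopingAlgebra.ι ℂ : Sl2 →ₗ⁅ℂ⁆ UniversalEnvelopingAlgebra ℂ Sl2).toLinearMap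
    (x • (UniversalEnvelopingAlgebra.ι ℂ : Sl2 →ₗ⁅ℂ⁆ UniversalEnvelopingAlgebra ℂ Sl2).toLinearMap)
    (by intro a b; simp [Ring.lie_def])
    (by intro a b; simp [Ring.lie_def, smul_sub])
    (by
      have hef : UniversalEnvelopingAlgebra.ι ℂ e * UniversalEnvelopingAlgebra.ι ℂ f -
          UniversalEnvelopingAlgebra.ι ℂ f * UniversalEnvelopingAlgebra.ι ℂ e =
          (2 : ℂ) • UniversalEnvelopingAlgebra.ι ℂ h := by
        rw [← Ring.lie_def, ← LieHom.map_lie, lie_e_f, map_smul]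
      simp [-UniversalEnvelopingAlgebra.ι_apply, ← smul_sub, hef]
      right
      rw [smul_comm x (2 : ℂ), sub_self])

/-- The Casimir tensor `Ω = e ⊗ f + f ⊗ e + 2 h ⊗ h`. -/
def Omega : Yangian ⊗[ℂ] Yangian :=
  gen e ⊗ₜ gen f + gen f ⊗ₜ gen e + (2 : ℂ) • (gen h ⊗ₜ gen h)

/-- `Δ(a) = a ⊗ 1 + 1 ⊗ a`. -/
def comulGen : Sl2 →ₗ[ℂ] Yangian ⊗[ℂ] Yangian :=
  (TensorProduct.mk ℂ Yangian Yangian).flip 1 ∘ₗ gen + TensorProduct.mk ℂ Yangian Yangian 1 ∘ₗ gen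

/-- `Δ(J(a)) = J(a) ⊗ 1 + 1 ⊗ J(a) + [1 ⊗ a, Ω] / 2`. -/
def comulJ : Sl2 →ₗ[ℂ] Yangian ⊗[ℂ] Yangian :=
  (TensorProduct.mk ℂ Yangian Yangian).flip 1 ∘ₗ J + TensorProduct.mk ℂ Yangian Yangian 1 ∘ₗ J +
    (1 / 2 : ℂ) • ((LinearMap.mulRight ℂ Omega - LinearMap.mulLeft ℂ Omega) ∘ₗ
      TensorProduct.mk ℂ Yangian Yangian 1 ∘ₗ gen)

theorem comulGen_apply (a : Sl2) : comulGen a = gen a ⊗ₜ 1 + 1 ⊗ₜ gen a := rfl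

theorem comulJ_apply (a : Sl2) : comulJ a = J a ⊗ₜ 1 + 1 ⊗ₜ J a +
    (1 / 2 : ℂ) • ((1 ⊗ₜ gen a) * Omega - Omega * (1 ⊗ₜ gen a)) := rfl

theorem gen_comm (a b : Sl2) : gen a * gen b = gen b * gen a + gen ⁅a, b⁆ := by
  rw [← gen_gen a b]; abel

theorem gen_J_comm (a b : Sl2) : gen a * J b = J b * gen a + J ⁅a, b⁆ := by
  rw [← gen_J a b]; abel

theorem comulGen_gen_right (a b : Sl2) : comulGen a * ((1 : Yangian) ⊗ₜ[ℂ] gen b) =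
    (1 ⊗ₜ gen b) * comulGen a + 1 ⊗ₜ gen ⁅a, b⁆ := by
  simp only [comulGen_apply, add_mul, mul_add, Algebra.TensorProduct.tmul_mul_tmul, mul_one,
    one_mul, gen_comm a b, TensorProduct.tmul_add]
  abel

theorem lie_f_e : ⁅f, e⁆ = -((2 : ℂ) • h) := by rw [← lie_skew, lie_e_f]

theorem lie_e_h : ⁅e, h⁆ = -e := by rw [← lie_skew, lie_h_e]

theorem lie_f_h : ⁅f, h⁆ = f := by rw [← lie_skew, lie_h_f, neg_neg]

theorem comulGen_Omega (a : Sl2) : comulGen a * Omega = Omega * comulGen a := by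
  have key : ∀ b : Sl2, comulGen b * Omega - Omega * comulGen b =
      (gen ⁅b, e⁆ ⊗ₜ gen f + gen e ⊗ₜ gen ⁅b, f⁆) + (gen ⁅b, f⁆ ⊗ₜ gen e + gen f ⊗ₜ gen ⁅b, e⁆) +
      (2 : ℂ) • (gen ⁅b, h⁆ ⊗ₜ gen h + gen h ⊗ₜ gen ⁅b, h⁆) := by
    intro b
    simp only [comulGen_apply, Omega, add_mul, mul_add, mul_smul_comm, smul_mul_assoc, smul_add,
      Algebra.TensorProduct.tmul_mul_tmul, mul_one, one_mul, gen_comm b e, gen_comm b f,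
      gen_comm b h, TensorProduct.tmul_add, TensorProduct.add_tmul]
    abel
  rw [sl2_decomp a]
  simp only [map_add, map_smul, add_mul, mul_add, smul_mul_assoc, mul_smul_comm]
  have hz : ∀ b : Sl2, b = e ∨ b = f ∨ b = h → comulGen b * Omega = Omega * comulGen b := by
    intro b hb
    rw [← sub_eq_zero, key]
    rcases hb with rfl | rfl | rfl <;>
    simp only [lie_self, lie_e_f, lie_h_e, lie_h_f, lie_f_e, lie_f_h, lie_e_h, map_neg, map_smul,
      map_zero, TensorProduct.neg_tmul, TensorProduct.tmul_neg, ← TensorProduct.smul_tmul',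
      TensorProduct.tmul_smul, TensorProduct.zero_tmul, TensorProduct.tmul_zero] <;> module
  rw [hz e (by simp), hz f (by simp), hz h (by simp)]

theorem comul_gen_gen (a b : Sl2) :
    comulGen a * comulGen b - comulGen b * comulGen a = comulGen ⁅a, b⁆ := by
  simp only [comulGen_apply, add_mul, mul_add, Algebra.TensorProduct.tmul_mul_tmul, mul_one,
    one_mul, gen_comm a b, TensorProduct.tmul_add, TensorProduct.add_tmul]
  abel

theorem comul_gen_J (a b : Sl2) :
    comulGen a * comulJ b - comulJ b * comulGen a = comulJ ⁅a, b⁆ := by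
  have h₁ : comulGen a * (J b ⊗ₜ 1 + 1 ⊗ₜ J b) =
      (J b ⊗ₜ 1 + 1 ⊗ₜ J b) * comulGen a + (J ⁅a, b⁆ ⊗ₜ 1 + 1 ⊗ₜ J ⁅a, b⁆) := by
    simp only [comulGen_apply, add_mul, mul_add, Algebra.TensorProduct.tmul_mul_tmul, mul_one,
      one_mul, gen_J_comm a b, TensorProduct.tmul_add, TensorProduct.add_tmul]
    abel
  have h₂ : comulGen a * ((1 ⊗ₜ gen b) * Omega - Omega * (1 ⊗ₜ gen b)) =
      ((1 ⊗ₜ gen b) * Omega - Omega * (1 ⊗ₜ gen b)) * comulGen a +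
      ((1 ⊗ₜ gen ⁅a, b⁆) * Omega - Omega * (1 ⊗ₜ gen ⁅a, b⁆)) := by
    rw [mul_sub, ← mul_assoc, ← mul_assoc, comulGen_Omega a, mul_assoc Omega (comulGen a),
      comulGen_gen_right, add_mul, mul_add, mul_assoc _ (comulGen a), comulGen_Omega a, sub_mul]
    simp only [mul_assoc]
    abel
  rw [comulJ_apply, comulJ_apply, mul_add, add_mul, h₁, mul_smul_comm, h₂, smul_mul_assoc, smul_add]
  abel

theorem comulJ_formula_e : comulJ e = J e ⊗ₜ 1 + 1 ⊗ₜ J e +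
    (gen e ⊗ₜ 1) * (1 ⊗ₜ gen h) - (gen h ⊗ₜ 1) * (1 ⊗ₜ gen e) := by
  rw [comulJ_apply]
  simp only [Omega, add_mul, mul_add, mul_smul_comm, smul_mul_assoc, smul_add,
      Algebra.TensorProduct.tmul_mul_tmul, mul_one, one_mul, gen_comm e f, gen_comm e h, lie_e_f,
      lie_e_h, TensorProduct.tmul_add, map_neg, map_smul, TensorProduct.tmul_neg,
      TensorProduct.tmul_smul]
  module

theorem comulJ_formula_f : comulJ f = J f ⊗ₜ 1 + 1 ⊗ₜ J f +
    (gen h ⊗ₜ 1) * (1 ⊗ₜ gen f) - (gen f ⊗ₜ 1) * (1 ⊗ₜ gen h) := by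
  rw [comulJ_apply]
  simp only [Omega, add_mul, mul_add, mul_smul_comm, smul_mul_assoc, smul_add,
      Algebra.TensorProduct.tmul_mul_tmul, mul_one, one_mul, gen_comm f e, gen_comm f h, lie_f_e,
      lie_f_h, TensorProduct.tmul_add, map_neg, map_smul, TensorProduct.tmul_neg,
      TensorProduct.tmul_smul]
  module

theorem comulJ_formula_h : comulJ h = J h ⊗ₜ 1 + 1 ⊗ₜ J h +
    (1 / 2 : ℂ) • ((gen f ⊗ₜ 1) * (1 ⊗ₜ gen e) - (gen e ⊗ₜ 1) * (1 ⊗ₜ gen f)) := by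
  rw [comulJ_apply]
  simp only [Omega, add_mul, mul_add, mul_smul_comm, smul_mul_assoc, smul_add,
      Algebra.TensorProduct.tmul_mul_tmul, mul_one, one_mul, gen_comm h e, gen_comm h f, lie_h_f,
      lie_h_e, TensorProduct.tmul_add, map_neg, map_smul, TensorProduct.tmul_neg,
      TensorProduct.tmul_smul]
  module

theorem left_rel {x y z w : Yangian} (hr : x * y = z * x + w) :
    (x ⊗ₜ[ℂ] (1 : Yangian)) * (y ⊗ₜ 1) = (z ⊗ₜ 1) * (x ⊗ₜ 1) + w ⊗ₜ 1 := by
  simp [hr, TensorProduct.add_tmul]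

theorem right_rel {x y z w : Yangian} (hr : x * y = z * x + w) :
    ((1 : Yangian) ⊗ₜ[ℂ] x) * (1 ⊗ₜ y) = (1 ⊗ₜ z) * (1 ⊗ₜ x) + 1 ⊗ₜ w := by
  simp [hr, TensorProduct.tmul_add]

theorem J_J_J' : J e * J f * J h - J f * J e * J h - J h * J e * J f + J h * J f * J e =
    J e * gen f * gen h - gen e * J f * gen h := by
  have := J_J_J
  simp only [sub_mul, mul_sub, ← mul_assoc] at this
  rw [← this]
  abel

theorem comul_J_J_J :
    (comulJ e * comulJ f - comulJ f * comulJ e) * comulJ h -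
      comulJ h * (comulJ e * comulJ f - comulJ f * comulJ e) =
    (comulJ e * comulGen f - comulGen e * comulJ f) * comulGen h := by
  refine cubic (gen e ⊗ₜ 1) (gen f ⊗ₜ 1) (gen h ⊗ₜ 1) (J e ⊗ₜ 1) (J f ⊗ₜ 1) (J h ⊗ₜ 1)
    (1 ⊗ₜ gen e) (1 ⊗ₜ gen f) (1 ⊗ₜ gen h) (1 ⊗ₜ J e) (1 ⊗ₜ J f) (1 ⊗ₜ J h)
    ?_ ?_ ?_ ?_ ?_ ?_ ?_ ?_ ?_ ?_ ?_ ?_ ?_ ?_ ?_ ?_ ?_ ?_ ?_ ?_ ?_ ?_ ?_ ?_ ?_ ?_ ?_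
    _ _ _ comulJ_formula_e comulJ_formula_f comulJ_formula_h
  case refine_25 =>
    have := congrArg (fun y => y ⊗ₜ[ℂ] (1 : Yangian)) J_J_J'
    simpa [TensorProduct.sub_tmul, TensorProduct.add_tmul] using this
  case refine_26 =>
    have := congrArg (fun y => (1 : Yangian) ⊗ₜ[ℂ] y) J_J_J'
    simpa [TensorProduct.tmul_sub, TensorProduct.tmul_add] using this
  case refine_27 => simp
  all_goals
    first
    | rw [left_rel (gen_comm _ _)]
    | rw [right_rel (gen_comm _ _)]
    | rw [left_rel (gen_J_comm _ _)]
    | rw [right_rel (gen_J_comm _ _)]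
    simp [lie_e_f, lie_h_e, lie_h_f, lie_f_e, lie_f_h, lie_e_h, sub_eq_add_neg,
      TensorProduct.neg_tmul, TensorProduct.tmul_neg, TensorProduct.smul_tmul']

/-- The comultiplication of the Yangian. -/
def comul : Yangian →ₐ[ℂ] Yangian ⊗[ℂ] Yangian :=
  lift comulGen comulJ comul_gen_gen comul_gen_J comul_J_J_J

end Yangian

/-! ### Evaluation modules, their tensor products, and the rational `R`-matrix -/

section RMatrix

variable {M N : Type*} [AddCommGroup M] [Module ℂ M] [LieRingModule Sl2 M] [LieModule ℂ Sl2 M]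
  [AddCommGroup N] [Module ℂ N] [LieRingModule Sl2 N] [LieModule ℂ Sl2 N]

/-- The Yangian module `M(x)`: the `sl₂`-module `M` pulled back along the evaluation map. -/
def evalRep (M : Type*) [AddCommGroup M] [Module ℂ M] [LieRingModule Sl2 M] [LieModule ℂ Sl2 M]
    (x : ℂ) : Yangian →ₐ[ℂ] Module.End ℂ M :=
  (UniversalEnvelopingAlgebra.lift ℂ (LieModule.toEnd ℂ Sl2 M)).comp (Yangian.eval x)

/-- The Yangian module `M(x) ⊗ N(y)`. -/
def tensorRep (M N : Type*) [AddCommGroup M] [Module ℂ M] [LieRingModule Sl2 M]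
    [LieModule ℂ Sl2 M] [AddCommGroup N] [Module ℂ N] [LieRingModule Sl2 N] [LieModule ℂ Sl2 N]
    (x y : ℂ) : Yangian →ₐ[ℂ] Module.End ℂ (M ⊗[ℂ] N) :=
  (Module.endTensorEndAlgHom (R := ℂ) (S := ℂ) (A := ℂ) (M := M) (N := N)).comp
    ((Algebra.TensorProduct.map (evalRep M x) (evalRep N y)).comp Yangian.comul)

/-- `P R : M(x) ⊗ N(y) → N(y) ⊗ M(x)` is a homomorphism of Yangian modules, for all `x, y` with
`x - y = z`, and sends `v ⊗ w` to `w ⊗ v`; here `P` is the permutation of the factors. -/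
structure IsNormalizedIntertwiner (v : M) (w : N) (z : ℂ) (R : Module.End ℂ (M ⊗[ℂ] N)) :
    Prop where
  intertwines : ∀ x y : ℂ, x - y = z → ∀ (a : Yangian) (t : M ⊗[ℂ] N),
    TensorProduct.comm ℂ M N (R (tensorRep M N x y a t)) =
      tensorRep N M y x a (TensorProduct.comm ℂ M N (R t))
  normalized : TensorProduct.comm ℂ M N (R (v ⊗ₜ w)) = w ⊗ₜ v

/-- `R` is the rational `R`-matrix `R_{M N}(z)` of the highest weight modules `M`, `N` with highest
weight vectors `v`, `w`: the unique normalized intertwiner. -/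
def IsRationalRMatrix (v : M) (w : N) (z : ℂ) (R : Module.End ℂ (M ⊗[ℂ] N)) : Prop :=
  IsNormalizedIntertwiner v w z R ∧ ∀ R', IsNormalizedIntertwiner v w z R' → R' = R

end RMatrix

/-! ### Meromorphic functions of several variables -/

/-- `F` is meromorphic: near each point it is a quotient of holomorphic functions, with a
denominator which is not identically zero near the point (values of `F` at zeros of the denominator
are irrelevant). -/
def IsMeromorphic {E : Type*} [NormedAddCommGroup E] [NormedSpace ℂ E] (F : E → ℂ) : Prop :=
  ∀ p : E, ∃ g k : E → ℂ, AnalyticAt ℂ g p ∧ AnalyticAt ℂ k p ∧ (¬ ∀ᶠ q in nhds p, k q = 0) ∧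
    ∀ᶠ q in nhds p, k q ≠ 0 → F q = g q / k q

/-- The distinguished basis `f ^ i v₁ ⊗ f ^ j v₂` of `V_{lam₁} ⊗ V_{lam₂}`. -/
def tensorBasis (lam₁ lam₂ : ℂ) : Module.Basis (ℕ × ℕ) ℂ (Verma lam₁ ⊗[ℂ] Verma lam₂) :=
  (vermaBasis lam₁).tensorProduct (vermaBasis lam₂)

/-- The matrix entry, in the distinguished bases, of a family of operators on
`V_{lam₁} ⊗ V_{lam₂}`, as a function of `(x, lam₁, lam₂)`. -/
def entry (R : ∀ lam₁ lam₂ : ℂ, ℂ → Module.End ℂ (Verma lam₁ ⊗[ℂ] Verma lam₂)) (i j : ℕ × ℕ)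
    (p : ℂ × ℂ × ℂ) : ℂ :=
  (tensorBasis p.2.1 p.2.2).repr (R p.2.1 p.2.2 p.1 (tensorBasis p.2.1 p.2.2 j)) i

/-- `x` avoids the hyperplanes `x - lam₁ - lam₂ + s = 0`, `s = 0, 1, 2, …`. -/
def OffPoles (x lam₁ lam₂ : ℂ) : Prop := ∀ s : ℕ, x - lam₁ - lam₂ + s ≠ 0

end RationalR

end

open scoped TensorProduct

noncomputable section

namespace RationalR

/-! The Yangian is generated by `e`, `f` and `J(f)`, so a normalized intertwiner is an operator that
commutes with the diagonal `e` and `f`, carries `lowerJ` to `lowerJOp`, and fixes the top vector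
(`isNormalizedIntertwiner_iff`).

Write `v`, `w` for the highest weight vectors and `Δ(f)` for the diagonal action of `f`. Then `J(f)`
sends `v ⊗ f ^ k w` to `-(x - l₁ - l₂ + k) (v ⊗ f ^ (k+1) w)` modulo the image of `Δ(f)`, and `Δ(f)`
recovers `f ^ (i+1) v ⊗ f ^ j w` from vectors with smaller `i`. Off the poles `V ⊗ V` is therefore
generated by `v ⊗ w` under the two lowering operators (`eq_zero_of_lowering`), and an intertwiner is
determined by its value there. This gives uniqueness, on `V ⊗ V` and on its quotients alike, and
explains the poles.

Existence comes from solving the recursion that `J(f)` imposes. The image of `v ⊗ f ^ k w` is `k! /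
∏_{s<k} (x - l₁ - l₂ + s)` times `imageNum`, a sum over `i + j = k` with polynomial coefficients
`imageCoeff`. Extending by commutation with `f` defines `vermaR`. Its compatibility with `e` and
`J(f)` need only be checked on the vectors `v ⊗ f ^ k w`, where it follows from two recurrences for
the coefficients (`diag_e_imageNum`, `lowerJOp_imageNum`).

When `2 l₂ = n`, the coefficient at `(i, j)` vanishes for `j ≤ n < i + j`, so `V ⊗ S` is preserved.
Uniqueness makes `vermaR` symmetric under the permutation of the factors (`comm_vermaR`), so `S ⊗ V`
is preserved too. The sum of the two is the kernel of the projection to `L ⊗ L`, whence the descent.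
Matrix entries are visibly entire functions divided by a finite product of the linear forms `x - l₁
- l₂ + s`. -/

/-! ### Intertwiners of Yangian modules -/

section Generators

variable {X Y : Type*} [AddCommGroup X] [Module ℂ X] [AddCommGroup Y] [Module ℂ Y]

/-- The elements of an algebra whose actions are intertwined by a given linear map. -/
def intertwinedSubalgebra {A : Type*} [Ring A] [Algebra ℂ A] (ρ : A →ₐ[ℂ] Module.End ℂ X)
    (σ : A →ₐ[ℂ] Module.End ℂ Y) (T : X →ₗ[ℂ] Y) : Subalgebra ℂ A where
  carrier := {a | ∀ t, T (ρ a t) = σ a (T t)}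
  mul_mem' {a b} ha hb t := by
    simp only [Set.mem_ofPred_eq] at ha hb
    simp [ha, hb]
  add_mem' {a b} ha hb t := by
    simp only [Set.mem_ofPred_eq] at ha hb
    simp [ha, hb]
  algebraMap_mem' r t := by simp [Module.algebraMap_end_apply]

/-- The Yangian is generated by `e`, `f` and `J(f)`. -/
theorem Yangian.subalgebra_eq_top (S : Subalgebra ℂ Yangian) (he : Yangian.gen e ∈ S)
    (hf : Yangian.gen f ∈ S) (hJ : Yangian.J f ∈ S) (a : Yangian) : a ∈ S := by
  -- The brackets `[e, f] = 2h`, `[e, J(f)] = 2 J(h)` and `[e, J(h)] = -J(e)` yield the remaining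
  -- generators.
  have hh : Yangian.gen h ∈ S := by
    have : Yangian.gen h = (1 / 2 : ℂ) • (Yangian.gen e * Yangian.gen f -
        Yangian.gen f * Yangian.gen e) := by
      rw [Yangian.gen_gen, lie_e_f, map_smul, smul_smul]; norm_num
    rw [this]
    exact S.smul_mem (S.sub_mem (S.mul_mem he hf) (S.mul_mem hf he)) _
  have hJh : Yangian.J h ∈ S := by
    have : Yangian.J h = (1 / 2 : ℂ) • (Yangian.gen e * Yangian.J f -
        Yangian.J f * Yangian.gen e) := by
      rw [Yangian.gen_J, lie_e_f, map_smul, smul_smul]; norm_num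
    rw [this]
    exact S.smul_mem (S.sub_mem (S.mul_mem he hJ) (S.mul_mem hJ he)) _
  have hJe : Yangian.J e ∈ S := by
    have : Yangian.J e = -(Yangian.gen e * Yangian.J h - Yangian.J h * Yangian.gen e) := by
      rw [Yangian.gen_J, Yangian.lie_e_h, map_neg, neg_neg]
    rw [this]
    exact S.neg_mem (S.sub_mem (S.mul_mem he hJh) (S.mul_mem hJh he))
  obtain ⟨p, rfl⟩ := RingQuot.mkAlgHom_surjective ℂ PreYangian.Rel a
  change Yangian.mk p ∈ S
  induction p using FreeAlgebra.induction with
  | grade0 r =>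
    rw [AlgHom.commutes]
    exact S.algebraMap_mem r
  | grade1 s =>
    rcases s with a | a
    · change Yangian.gen a ∈ S
      rw [sl2_decomp a]
      simp only [map_add, map_smul]
      exact S.add_mem (S.add_mem (S.smul_mem he _) (S.smul_mem hf _)) (S.smul_mem hh _)
    · change Yangian.J a ∈ S
      rw [sl2_decomp a]
      simp only [map_add, map_smul]
      exact S.add_mem (S.add_mem (S.smul_mem hJe _) (S.smul_mem hJ _)) (S.smul_mem hJh _)
  | mul a b ha hb => rw [map_mul]; exact S.mul_mem ha hb
  | add a b ha hb => rw [map_add]; exact S.add_mem ha hb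

/-- A linear map commuting with `e`, `f` and `J(f)` is a homomorphism of Yangian modules. -/
theorem intertwines_of_generators (ρ : Yangian →ₐ[ℂ] Module.End ℂ X)
    (σ : Yangian →ₐ[ℂ] Module.End ℂ Y) (T : X →ₗ[ℂ] Y)
    (he : ∀ t, T (ρ (Yangian.gen e) t) = σ (Yangian.gen e) (T t))
    (hf : ∀ t, T (ρ (Yangian.gen f) t) = σ (Yangian.gen f) (T t))
    (hJ : ∀ t, T (ρ (Yangian.J f) t) = σ (Yangian.J f) (T t)) (a : Yangian) (t : X) :
    T (ρ a t) = σ a (T t) :=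
  Yangian.subalgebra_eq_top (intertwinedSubalgebra ρ σ T) he hf hJ a t

end Generators

/-! ### Generators acting on tensor products of evaluation modules -/

section TensorRep

variable {M N : Type*} [AddCommGroup M] [Module ℂ M] [LieRingModule Sl2 M] [LieModule ℂ Sl2 M]
  [AddCommGroup N] [Module ℂ N] [LieRingModule Sl2 N] [LieModule ℂ Sl2 N]

theorem evalRep_gen (x : ℂ) (a : Sl2) (m : M) : evalRep M x (Yangian.gen a) m = ⁅a, m⁆ := by
  simp [evalRep, Yangian.eval, Yangian.lift_gen, UniversalEnvelopingAlgebra.lift_ι_apply,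
    -UniversalEnvelopingAlgebra.ι_apply]

theorem evalRep_J (x : ℂ) (a : Sl2) (m : M) : evalRep M x (Yangian.J a) m = x • ⁅a, m⁆ := by
  simp [evalRep, Yangian.eval, Yangian.lift_J, UniversalEnvelopingAlgebra.lift_ι_apply,
    -UniversalEnvelopingAlgebra.ι_apply]

theorem tensorRep_gen_tmul (x y : ℂ) (a : Sl2) (m : M) (n : N) :
    tensorRep M N x y (Yangian.gen a) (m ⊗ₜ n) = ⁅a, m⁆ ⊗ₜ n + m ⊗ₜ ⁅a, n⁆ := by
  simp [tensorRep, Yangian.comul, Yangian.lift_gen, Yangian.comulGen_apply, evalRep_gen,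
    Module.endTensorEndAlgHom_apply]

theorem tensorRep_J_f_tmul (x y : ℂ) (m : M) (n : N) :
    tensorRep M N x y (Yangian.J f) (m ⊗ₜ n) = x • (⁅f, m⁆ ⊗ₜ n) + y • (m ⊗ₜ ⁅f, n⁆) +
      ⁅h, m⁆ ⊗ₜ ⁅f, n⁆ - ⁅f, m⁆ ⊗ₜ ⁅h, n⁆ := by
  simp [tensorRep, Yangian.comul, Yangian.lift_J, Yangian.comulJ_formula_f, evalRep_gen,
    evalRep_J, Module.endTensorEndAlgHom_apply, TensorProduct.smul_tmul']

end TensorRep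

/-! ### Operators on tensor products -/

section Operators

variable (M N : Type*) [AddCommGroup M] [Module ℂ M] [LieRingModule Sl2 M] [LieModule ℂ Sl2 M]
  [AddCommGroup N] [Module ℂ N] [LieRingModule Sl2 N] [LieModule ℂ Sl2 N]

/-- The diagonal action of `a ∈ sl₂` on `M ⊗ N`. -/
def diag (a : Sl2) : Module.End ℂ (M ⊗[ℂ] N) :=
  TensorProduct.map (LieModule.toEnd ℂ Sl2 M a) LinearMap.id +
    TensorProduct.map LinearMap.id (LieModule.toEnd ℂ Sl2 N a)

/-- The action of `J(f)` on `M(0) ⊗ N(-z)`. -/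
def lowerJ (z : ℂ) : Module.End ℂ (M ⊗[ℂ] N) :=
  TensorProduct.map (LieModule.toEnd ℂ Sl2 M h) (LieModule.toEnd ℂ Sl2 N f) -
    TensorProduct.map (LieModule.toEnd ℂ Sl2 M f) (LieModule.toEnd ℂ Sl2 N h) -
    z • TensorProduct.map LinearMap.id (LieModule.toEnd ℂ Sl2 N f)

/-- The action of `J(f)` on `N(-z) ⊗ M(0)`, with the factors permuted. -/
def lowerJOp (z : ℂ) : Module.End ℂ (M ⊗[ℂ] N) :=
  TensorProduct.map (LieModule.toEnd ℂ Sl2 M f) (LieModule.toEnd ℂ Sl2 N h) -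
    TensorProduct.map (LieModule.toEnd ℂ Sl2 M h) (LieModule.toEnd ℂ Sl2 N f) -
    z • TensorProduct.map LinearMap.id (LieModule.toEnd ℂ Sl2 N f)

variable {M N}

theorem diag_tmul (a : Sl2) (m : M) (n : N) :
    diag M N a (m ⊗ₜ n) = ⁅a, m⁆ ⊗ₜ n + m ⊗ₜ ⁅a, n⁆ := by
  simp [diag]

theorem lowerJ_tmul (z : ℂ) (m : M) (n : N) : lowerJ M N z (m ⊗ₜ n) =
    ⁅h, m⁆ ⊗ₜ ⁅f, n⁆ - ⁅f, m⁆ ⊗ₜ ⁅h, n⁆ - z • (m ⊗ₜ ⁅f, n⁆) := by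
  simp [lowerJ]

theorem lowerJOp_tmul (z : ℂ) (m : M) (n : N) : lowerJOp M N z (m ⊗ₜ n) =
    ⁅f, m⁆ ⊗ₜ ⁅h, n⁆ - ⁅h, m⁆ ⊗ₜ ⁅f, n⁆ - z • (m ⊗ₜ ⁅f, n⁆) := by
  simp [lowerJOp]

theorem tensorRep_gen (x y : ℂ) (a : Sl2) (t : M ⊗[ℂ] N) :
    tensorRep M N x y (Yangian.gen a) t = diag M N a t := by
  induction t using TensorProduct.induction_on with
  | zero => simp
  | add s t hs ht => simp only [map_add, hs, ht]
  | tmul m n => rw [tensorRep_gen_tmul, diag_tmul]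

/-- The parameters enter only through `x - y`, up to a multiple of the diagonal `f`, which an
intertwiner respects anyway. Hence the condition for all pairs `(x, y)` reduces to a single
identity. -/
theorem tensorRep_J_f (x y : ℂ) (t : M ⊗[ℂ] N) :
    tensorRep M N x y (Yangian.J f) t = lowerJ M N (x - y) t + x • diag M N f t := by
  induction t using TensorProduct.induction_on with
  | zero => simp
  | add s t hs ht => simp only [map_add, hs, ht]; module
  | tmul m n => rw [tensorRep_J_f_tmul, diag_tmul, lowerJ_tmul]; module

theorem comm_diag (a : Sl2) (t : M ⊗[ℂ] N) :
    TensorProduct.comm ℂ M N (diag M N a t) = diag N M a (TensorProduct.comm ℂ M N t) := by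
  induction t using TensorProduct.induction_on with
  | zero => simp
  | add s t hs ht => simp only [map_add, hs, ht]
  | tmul m n => simp [diag_tmul, add_comm]

theorem tensorRep_J_f_comm (x y : ℂ) (t : M ⊗[ℂ] N) :
    tensorRep N M y x (Yangian.J f) (TensorProduct.comm ℂ M N t) =
      TensorProduct.comm ℂ M N (lowerJOp M N (x - y) t + x • diag M N f t) := by
  induction t using TensorProduct.induction_on with
  | zero => simp
  | add s t hs ht => rw [map_add, map_add, hs, ht]; simp only [map_add, smul_add]; abel
  | tmul m n =>
    simp only [TensorProduct.comm_tmul, tensorRep_J_f_tmul, diag_tmul, lowerJOp_tmul, map_add,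
      map_sub, map_smul]
    module

/-- `lowerJOp` transforms by the same rule, so for an operator commuting with `f` the condition
relating `lowerJ` to `lowerJOp` is invariant under permuting the factors. -/
theorem comm_lowerJ (z : ℂ) (t : M ⊗[ℂ] N) : TensorProduct.comm ℂ M N (lowerJ M N z t) =
    -lowerJ N M z (TensorProduct.comm ℂ M N t) - z • diag N M f (TensorProduct.comm ℂ M N t) := by
  induction t using TensorProduct.induction_on with
  | zero => simp
  | add s t hs ht => simp only [map_add, hs, ht]; module
  | tmul m n =>
    simp only [TensorProduct.comm_tmul, diag_tmul, lowerJ_tmul, map_sub, map_smul]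
    module

theorem comm_lowerJOp (z : ℂ) (t : M ⊗[ℂ] N) : TensorProduct.comm ℂ M N (lowerJOp M N z t) =
    -lowerJOp N M z (TensorProduct.comm ℂ M N t) -
      z • diag N M f (TensorProduct.comm ℂ M N t) := by
  induction t using TensorProduct.induction_on with
  | zero => simp
  | add s t hs ht => simp only [map_add, hs, ht]; module
  | tmul m n =>
    simp only [TensorProduct.comm_tmul, diag_tmul, lowerJOp_tmul, map_sub, map_smul]
    module

/-- A normalized intertwiner is characterized by its commutation with `e`, `f` and `J(f)`. -/
theorem isNormalizedIntertwiner_iff (v : M) (w : N) (z : ℂ) (R : Module.End ℂ (M ⊗[ℂ] N)) :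
    IsNormalizedIntertwiner v w z R ↔ (∀ t, R (diag M N e t) = diag M N e (R t)) ∧
      (∀ t, R (diag M N f t) = diag M N f (R t)) ∧
      (∀ t, R (lowerJ M N z t) = lowerJOp M N z (R t)) ∧ R (v ⊗ₜ w) = v ⊗ₜ w := by
  have hnorm : TensorProduct.comm ℂ M N (R (v ⊗ₜ w)) = w ⊗ₜ v ↔ R (v ⊗ₜ w) = v ⊗ₜ w := by
    rw [← TensorProduct.comm_tmul ℂ M N v w, EmbeddingLike.apply_eq_iff_eq]
  constructor
  · rintro ⟨hi, hn⟩
    have hd : ∀ a t, R (diag M N a t) = diag M N a (R t) := by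
      intro a t
      apply (TensorProduct.comm ℂ M N).injective
      have := hi z 0 (sub_zero z) (Yangian.gen a) t
      rwa [tensorRep_gen, tensorRep_gen, ← comm_diag] at this
    refine ⟨hd e, hd f, fun t => ?_, hnorm.1 hn⟩
    apply (TensorProduct.comm ℂ M N).injective
    -- At the pair `(z, 0)` both sides carry the same extra term `z • diag f`, which cancels.
    have := hi z 0 (sub_zero z) (Yangian.J f) t
    rw [tensorRep_J_f, tensorRep_J_f_comm, sub_zero, map_add, map_smul, hd, map_add, map_add] at this
    exact add_right_cancel this
  · rintro ⟨he, hf, hJ, hn⟩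
    refine ⟨fun x y hxy a t => ?_, hnorm.2 hn⟩
    refine intertwines_of_generators (tensorRep M N x y) (tensorRep N M y x)
      ((TensorProduct.comm ℂ M N).toLinearMap ∘ₗ R) ?_ ?_ ?_ a t <;> intro t <;>
      simp only [LinearMap.comp_apply, LinearEquiv.coe_coe]
    · rw [tensorRep_gen, tensorRep_gen, he, comm_diag]
    · rw [tensorRep_gen, tensorRep_gen, hf, comm_diag]
    · rw [tensorRep_J_f, tensorRep_J_f_comm, hxy, map_add, map_smul, hf, hJ]

/-! ### Compatibility with homomorphisms of `sl₂`-modules -/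

section Map

variable {M' N' : Type*} [AddCommGroup M'] [Module ℂ M'] [LieRingModule Sl2 M']
    [LieModule ℂ Sl2 M'] [AddCommGroup N'] [Module ℂ N'] [LieRingModule Sl2 N']
    [LieModule ℂ Sl2 N'] (φ : M →ₗ⁅ℂ, Sl2⁆ M') (ψ : N →ₗ⁅ℂ, Sl2⁆ N')

theorem map_diag (a : Sl2) (t : M ⊗[ℂ] N) :
    TensorProduct.map (φ : M →ₗ[ℂ] M') (ψ : N →ₗ[ℂ] N') (diag M N a t) =
      diag M' N' a (TensorProduct.map (φ : M →ₗ[ℂ] M') (ψ : N →ₗ[ℂ] N') t) := by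
  induction t using TensorProduct.induction_on with
  | zero => simp
  | add s t hs ht => simp only [map_add, hs, ht]
  | tmul m n => simp [diag_tmul]

theorem map_lowerJ (z : ℂ) (t : M ⊗[ℂ] N) :
    TensorProduct.map (φ : M →ₗ[ℂ] M') (ψ : N →ₗ[ℂ] N') (lowerJ M N z t) =
      lowerJ M' N' z (TensorProduct.map (φ : M →ₗ[ℂ] M') (ψ : N →ₗ[ℂ] N') t) := by
  induction t using TensorProduct.induction_on with
  | zero => simp
  | add s t hs ht => simp only [map_add, hs, ht]
  | tmul m n => simp [lowerJ_tmul]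

theorem map_lowerJOp (z : ℂ) (t : M ⊗[ℂ] N) :
    TensorProduct.map (φ : M →ₗ[ℂ] M') (ψ : N →ₗ[ℂ] N') (lowerJOp M N z t) =
      lowerJOp M' N' z (TensorProduct.map (φ : M →ₗ[ℂ] M') (ψ : N →ₗ[ℂ] N') t) := by
  induction t using TensorProduct.induction_on with
  | zero => simp
  | add s t hs ht => simp only [map_add, hs, ht]
  | tmul m n => simp [lowerJOp_tmul]

end Map

end Operators

/-! ### The operators in the distinguished basis -/

section Basis

variable (l₁ l₂ : ℂ)

theorem lie_e_vermaBasis (lam : ℂ) (i : ℕ) : ⁅e, vermaBasis lam i⁆ =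
    ((i : ℂ) * (2 * lam - i + 1)) • vermaBasis lam (i - 1) := by
  simp [verma_lie, e]

theorem lie_f_vermaBasis (lam : ℂ) (i : ℕ) :
    ⁅f, vermaBasis lam i⁆ = vermaBasis lam (i + 1) := by
  simp [verma_lie, f]

theorem lie_h_vermaBasis (lam : ℂ) (i : ℕ) :
    ⁅h, vermaBasis lam i⁆ = (lam - i) • vermaBasis lam i := by
  simp [verma_lie, h]

theorem tensorBasis_apply (i j : ℕ) :
    tensorBasis l₁ l₂ (i, j) = vermaBasis l₁ i ⊗ₜ vermaBasis l₂ j :=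
  Module.Basis.tensorProduct_apply _ _ _ _

theorem diag_f_basis (i j : ℕ) : diag (Verma l₁) (Verma l₂) f (tensorBasis l₁ l₂ (i, j)) =
    tensorBasis l₁ l₂ (i + 1, j) + tensorBasis l₁ l₂ (i, j + 1) := by
  simp [tensorBasis_apply, diag_tmul, lie_f_vermaBasis]

theorem diag_h_basis (i j : ℕ) : diag (Verma l₁) (Verma l₂) h (tensorBasis l₁ l₂ (i, j)) =
    (l₁ + l₂ - i - j) • tensorBasis l₁ l₂ (i, j) := by
  simp only [tensorBasis_apply, diag_tmul, lie_h_vermaBasis, TensorProduct.tmul_smul,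
    ← TensorProduct.smul_tmul']
  module

theorem diag_e_basis (i j : ℕ) : diag (Verma l₁) (Verma l₂) e (tensorBasis l₁ l₂ (i, j)) =
    ((i : ℂ) * (2 * l₁ - i + 1)) • tensorBasis l₁ l₂ (i - 1, j) +
      ((j : ℂ) * (2 * l₂ - j + 1)) • tensorBasis l₁ l₂ (i, j - 1) := by
  simp only [tensorBasis_apply, diag_tmul, lie_e_vermaBasis, TensorProduct.tmul_smul,
    ← TensorProduct.smul_tmul']

theorem lowerJ_basis (z : ℂ) (i j : ℕ) :
    lowerJ (Verma l₁) (Verma l₂) z (tensorBasis l₁ l₂ (i, j)) =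
      (l₁ - i - z) • tensorBasis l₁ l₂ (i, j + 1) - (l₂ - j) • tensorBasis l₁ l₂ (i + 1, j) := by
  simp only [tensorBasis_apply, lowerJ_tmul, lie_f_vermaBasis, lie_h_vermaBasis,
    TensorProduct.tmul_smul, ← TensorProduct.smul_tmul']
  module

theorem lowerJOp_basis (z : ℂ) (i j : ℕ) :
    lowerJOp (Verma l₁) (Verma l₂) z (tensorBasis l₁ l₂ (i, j)) =
      (l₂ - j) • tensorBasis l₁ l₂ (i + 1, j) - (l₁ - i + z) • tensorBasis l₁ l₂ (i, j + 1) := by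
  simp only [tensorBasis_apply, lowerJOp_tmul, lie_f_vermaBasis, lie_h_vermaBasis,
    TensorProduct.tmul_smul, ← TensorProduct.smul_tmul']
  module

/-- This reflects `[f, J(f)] = J([f, f]) = 0`. It makes the defect of commutation with `J(f)` vanish
on an `f`-stable subspace. -/
theorem diag_f_lowerJ (z : ℂ) (t : Verma l₁ ⊗[ℂ] Verma l₂) :
    diag _ _ f (lowerJ _ _ z t) = lowerJ _ _ z (diag _ _ f t) := by
  suffices H : diag (Verma l₁) (Verma l₂) f ∘ₗ lowerJ _ _ z = lowerJ _ _ z ∘ₗ diag _ _ f from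
    LinearMap.congr_fun H t
  apply (tensorBasis l₁ l₂).ext
  rintro ⟨i, j⟩
  simp only [LinearMap.comp_apply, lowerJ_basis, diag_f_basis, map_add, map_sub, map_smul]
  push_cast
  module

theorem diag_f_lowerJOp (z : ℂ) (t : Verma l₁ ⊗[ℂ] Verma l₂) :
    diag _ _ f (lowerJOp _ _ z t) = lowerJOp _ _ z (diag _ _ f t) := by
  suffices H : diag (Verma l₁) (Verma l₂) f ∘ₗ lowerJOp _ _ z = lowerJOp _ _ z ∘ₗ diag _ _ f from
    LinearMap.congr_fun H t
  apply (tensorBasis l₁ l₂).ext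
  rintro ⟨i, j⟩
  simp only [LinearMap.comp_apply, lowerJOp_basis, diag_f_basis, map_add, map_sub, map_smul]
  push_cast
  module

theorem diag_h_diag_f (t : Verma l₁ ⊗[ℂ] Verma l₂) :
    diag _ _ h (diag _ _ f t) = diag _ _ f (diag _ _ h t) - diag _ _ f t := by
  suffices H : diag (Verma l₁) (Verma l₂) h ∘ₗ diag _ _ f = diag _ _ f ∘ₗ diag _ _ h - diag _ _ f
    from LinearMap.congr_fun H t
  apply (tensorBasis l₁ l₂).ext
  rintro ⟨i, j⟩
  simp only [LinearMap.comp_apply, LinearMap.sub_apply, diag_h_basis, diag_f_basis, map_add,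
    map_smul]
  push_cast
  module

theorem diag_e_diag_f (t : Verma l₁ ⊗[ℂ] Verma l₂) :
    diag _ _ e (diag _ _ f t) = diag _ _ f (diag _ _ e t) + (2 : ℂ) • diag _ _ h t := by
  suffices H : diag (Verma l₁) (Verma l₂) e ∘ₗ diag _ _ f =
      diag _ _ f ∘ₗ diag _ _ e + (2 : ℂ) • diag _ _ h from LinearMap.congr_fun H t
  apply TensorProduct.ext'
  intro m n
  simp only [LinearMap.comp_apply, LinearMap.add_apply, LinearMap.smul_apply, diag_tmul, map_add,
    leibniz_lie e f, lie_e_f, smul_lie, TensorProduct.add_tmul, TensorProduct.tmul_add,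
    TensorProduct.tmul_smul, ← TensorProduct.smul_tmul']
  module

variable {l₁ l₂}

/-- A linear map out of `V ⊗ V` vanishes if it kills the vectors `v ⊗ f ^ k w` and its kernel is
stable under `f`. -/
theorem eq_zero_of_diag_f {Z : Type*} [AddCommGroup Z] [Module ℂ Z]
    (T : Verma l₁ ⊗[ℂ] Verma l₂ →ₗ[ℂ] Z) (h₀ : ∀ k, T (tensorBasis l₁ l₂ (0, k)) = 0)
    (hf : ∀ t, T t = 0 → T (diag _ _ f t) = 0) : T = 0 := by
  apply (tensorBasis l₁ l₂).ext
  rintro ⟨i, j⟩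
  rw [LinearMap.zero_apply]
  induction i generalizing j with
  | zero => exact h₀ j
  | succ i ih =>
    -- `f ^ (i+1) v ⊗ f ^ j w` is `Δ(f) (f ^ i v ⊗ f ^ j w)` minus `f ^ i v ⊗ f ^ (j+1) w`, which is
    -- why the induction runs over all `j` at once.
    have := hf _ (ih j)
    rwa [diag_f_basis, map_add, ih, add_zero] at this

/-- Off the poles, `V ⊗ V` is generated by the highest weight vector under `f` and `J(f)`. -/
theorem eq_zero_of_lowering {x : ℂ} (hx : OffPoles x l₁ l₂) {Z : Type*} [AddCommGroup Z]
    [Module ℂ Z] (T : Verma l₁ ⊗[ℂ] Verma l₂ →ₗ[ℂ] Z)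
    (h₀ : T (vermaTop l₁ ⊗ₜ vermaTop l₂) = 0)
    (hf : ∀ t, T t = 0 → T (diag _ _ f t) = 0) (hJ : ∀ t, T t = 0 → T (lowerJ _ _ x t) = 0) :
    T = 0 := by
  refine eq_zero_of_diag_f T (fun k => ?_) hf
  induction k with
  | zero => rwa [tensorBasis_apply]
  | succ k ih =>
    -- Eliminating `f v ⊗ f ^ k w` between `J(f)` and `Δ(f)` leaves exactly the linear form excluded
    -- by `OffPoles`.
    have h₁ : lowerJ _ _ x (tensorBasis l₁ l₂ (0, k)) =
        -((x - l₁ - l₂ + k) • tensorBasis l₁ l₂ (0, k + 1)) -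
          (l₂ - k) • diag _ _ f (tensorBasis l₁ l₂ (0, k)) := by
      rw [lowerJ_basis, diag_f_basis]
      push_cast
      module
    have h₂ := hJ _ ih
    rw [h₁, map_sub, map_smul, hf _ ih, smul_zero, sub_zero, map_neg, neg_eq_zero, map_smul] at h₂
    exact (smul_eq_zero.1 h₂).resolve_left (hx k)

end Basis

/-! ### The `R`-matrix on a tensor product of Verma modules -/

section Construction

variable (l₁ l₂ x : ℂ)

/-- The coefficients of the polynomials `imageNum`. -/
def imageCoeff (i j : ℕ) : ℂ :=
  (∏ l ∈ Finset.range i, ((j : ℂ) + l - 2 * l₂)) * (∏ l ∈ Finset.range j, (x + l₁ - l₂ + l)) /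
    (i.factorial * j.factorial)

theorem imageCoeff_succ_left (i j : ℕ) : ((i : ℂ) + 1) * imageCoeff l₁ l₂ x (i + 1) j =
    ((i : ℂ) + j - 2 * l₂) * imageCoeff l₁ l₂ x i j := by
  have hi : (i.factorial : ℂ) ≠ 0 := by exact_mod_cast i.factorial_ne_zero
  have hj : (j.factorial : ℂ) ≠ 0 := by exact_mod_cast j.factorial_ne_zero
  have hi' : (i : ℂ) + 1 ≠ 0 := by exact_mod_cast i.succ_ne_zero
  rw [imageCoeff, imageCoeff, Finset.prod_range_succ, Nat.factorial_succ]
  push_cast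
  field_simp
  ring

/-- Raising `j` drops the first factor `j - 2 l₂` of the product over `i`. It is kept as a
multiplier, since it can vanish at dominant weights. -/
theorem imageCoeff_succ_right (i j : ℕ) :
    ((j : ℂ) - 2 * l₂) * (((j : ℂ) + 1) * imageCoeff l₁ l₂ x i (j + 1)) =
      (x + l₁ - l₂ + j) * (((i : ℂ) + 1) * imageCoeff l₁ l₂ x (i + 1) j) := by
  have hi : (i.factorial : ℂ) ≠ 0 := by exact_mod_cast i.factorial_ne_zero
  have hj : (j.factorial : ℂ) ≠ 0 := by exact_mod_cast j.factorial_ne_zero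
  have hi' : (i : ℂ) + 1 ≠ 0 := by exact_mod_cast i.succ_ne_zero
  have hj' : (j : ℂ) + 1 ≠ 0 := by exact_mod_cast j.succ_ne_zero
  have hp : ∀ l : ℕ, (j : ℂ) + ((l + 1 : ℕ) : ℂ) - 2 * l₂ = ((j + 1 : ℕ) : ℂ) + l - 2 * l₂ := by
    intro l; push_cast; ring
  rw [imageCoeff, imageCoeff, Finset.prod_range_succ' _ i, Finset.prod_range_succ _ j,
    Nat.factorial_succ, Nat.factorial_succ]
  simp only [hp]
  push_cast
  field_simp
  ring

theorem imageCoeff_succ_zero_right (j : ℕ) :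
    ((j : ℂ) + 1) * imageCoeff l₁ l₂ x 0 (j + 1) =
      (x + l₁ - l₂ + j) * imageCoeff l₁ l₂ x 0 j := by
  have hj : (j.factorial : ℂ) ≠ 0 := by exact_mod_cast j.factorial_ne_zero
  have hj' : (j : ℂ) + 1 ≠ 0 := by exact_mod_cast j.succ_ne_zero
  rw [imageCoeff, imageCoeff, Finset.prod_range_succ _ j, Nat.factorial_succ]
  push_cast
  field_simp
  simp

/-- After multiplication by `i + 1`, both terms on the left become multiples of the coefficient at
`(i, j + 1)`, and the factors `i + j + 1 - 2 l₂` and `j - 2 l₂` differ by `i + 1`. Only `i + 1` is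
cancelled. -/
theorem imageCoeff_succ_succ (i j : ℕ) :
    ((j : ℂ) + 1) * imageCoeff l₁ l₂ x (i + 1) (j + 1) -
      (x + l₁ - l₂ + j) * imageCoeff l₁ l₂ x (i + 1) j =
    ((j : ℂ) + 1) * imageCoeff l₁ l₂ x i (j + 1) := by
  have hi' : (i : ℂ) + 1 ≠ 0 := by exact_mod_cast i.succ_ne_zero
  have h₁ := imageCoeff_succ_left l₁ l₂ x i (j + 1)
  have h₂ := imageCoeff_succ_right l₁ l₂ x i j
  push_cast at h₁
  apply mul_left_cancel₀ hi'
  linear_combination ((j : ℂ) + 1) * h₁ + h₂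

/-- The image of `v ⊗ f ^ k w` under the `R`-matrix, up to a scalar. -/
def imageNum (k : ℕ) : Verma l₁ ⊗[ℂ] Verma l₂ :=
  ∑ p ∈ Finset.HasAntidiagonal.antidiagonal k, imageCoeff l₁ l₂ x p.1 p.2 • tensorBasis l₁ l₂ p

theorem imageNum_zero : imageNum l₁ l₂ x 0 = tensorBasis l₁ l₂ (0, 0) := by
  simp [imageNum, imageCoeff]

theorem diag_h_imageNum (k : ℕ) : diag _ _ h (imageNum l₁ l₂ x k) =
    (l₁ + l₂ - k) • imageNum l₁ l₂ x k := by
  rw [imageNum, map_sum, Finset.smul_sum]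
  refine Finset.sum_congr rfl fun p hp => ?_
  obtain ⟨i, j⟩ := p
  obtain rfl : i + j = k := Finset.HasAntidiagonal.mem_antidiagonal.1 hp
  rw [map_smul, diag_h_basis]
  push_cast
  module

/-- The factor `x - l₁ - l₂ + k` is the one by which consecutive values of `denom` differ, so after
normalization only the scalar of `e` on `f ^ (k+1) w` survives. -/
theorem diag_e_imageNum (k : ℕ) : diag _ _ e (imageNum l₁ l₂ x (k + 1)) =
    ((2 * l₂ - k) * (x - l₁ - l₂ + k)) • imageNum l₁ l₂ x k := by
  have h₁ : diag _ _ e (imageNum l₁ l₂ x (k + 1)) =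
      ∑ p ∈ Finset.HasAntidiagonal.antidiagonal (k + 1), (imageCoeff l₁ l₂ x p.1 p.2 *
        ((p.1 : ℂ) * (2 * l₁ - p.1 + 1))) • tensorBasis l₁ l₂ (p.1 - 1, p.2) +
      ∑ p ∈ Finset.HasAntidiagonal.antidiagonal (k + 1), (imageCoeff l₁ l₂ x p.1 p.2 *
        ((p.2 : ℂ) * (2 * l₂ - p.2 + 1))) • tensorBasis l₁ l₂ (p.1, p.2 - 1) := by
    rw [imageNum, map_sum, ← Finset.sum_add_distrib]
    refine Finset.sum_congr rfl fun p _ => ?_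
    obtain ⟨i, j⟩ := p
    rw [map_smul, diag_e_basis, smul_add, smul_smul, smul_smul]
  -- The boundary terms split off, where an index is `0` and its predecessor is truncated, have
  -- coefficient zero.
  rw [h₁, Finset.Nat.sum_antidiagonal_succ, Finset.Nat.sum_antidiagonal_succ', imageNum,
    Finset.smul_sum]
  simp only [Nat.cast_zero, zero_mul, mul_zero, zero_smul, zero_add,
    Nat.add_sub_cancel]
  rw [← Finset.sum_add_distrib]
  refine Finset.sum_congr rfl fun p hp => ?_
  obtain ⟨i, j⟩ := p
  obtain rfl : i + j = k := Finset.HasAntidiagonal.mem_antidiagonal.1 hp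
  rw [← add_smul, smul_smul]
  congr 1
  have h₂ := imageCoeff_succ_left l₁ l₂ x i j
  have h₃ := imageCoeff_succ_right l₁ l₂ x i j
  push_cast
  linear_combination (2 * l₁ - i - (x + l₁ - l₂ + j)) * h₂ - h₃

/-- This is the recursion forced on the images of `v ⊗ f ^ k w` by `f` and `J(f)`, cleared of
denominators. -/
theorem lowerJOp_imageNum (k : ℕ) :
    (l₂ - k) • diag _ _ f (imageNum l₁ l₂ x k) + lowerJOp _ _ x (imageNum l₁ l₂ x k) =
      -(((k : ℂ) + 1) • imageNum l₁ l₂ x (k + 1)) := by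
  have h₁ : ((k : ℂ) + 1) • imageNum l₁ l₂ x (k + 1) =
      ∑ p ∈ Finset.HasAntidiagonal.antidiagonal k, ((((p.1 : ℂ) + 1) * imageCoeff l₁ l₂ x (p.1 + 1) p.2) •
          tensorBasis l₁ l₂ (p.1 + 1, p.2) +
        (((p.2 : ℂ) + 1) * imageCoeff l₁ l₂ x p.1 (p.2 + 1)) •
          tensorBasis l₁ l₂ (p.1, p.2 + 1)) := by
    -- On the antidiagonal of `k + 1` the scalar splits as `i + j`; each half then loses one
    -- boundary term.
    have h₂ : ((k : ℂ) + 1) • imageNum l₁ l₂ x (k + 1) =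
        ∑ p ∈ Finset.HasAntidiagonal.antidiagonal (k + 1),
          ((p.1 : ℂ) * imageCoeff l₁ l₂ x p.1 p.2) • tensorBasis l₁ l₂ p +
        ∑ p ∈ Finset.HasAntidiagonal.antidiagonal (k + 1),
          ((p.2 : ℂ) * imageCoeff l₁ l₂ x p.1 p.2) • tensorBasis l₁ l₂ p := by
      rw [← Finset.sum_add_distrib, imageNum, Finset.smul_sum]
      refine Finset.sum_congr rfl fun p hp => ?_
      have hk : (p.1 : ℂ) + p.2 = k + 1 := by exact_mod_cast Finset.HasAntidiagonal.mem_antidiagonal.1 hp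
      rw [← hk]
      module
    rw [h₂, Finset.Nat.sum_antidiagonal_succ, Finset.Nat.sum_antidiagonal_succ',
      Finset.sum_add_distrib]
    simp
  have h₃ : (l₂ - k) • diag _ _ f (imageNum l₁ l₂ x k) + lowerJOp _ _ x (imageNum l₁ l₂ x k) =
      -∑ p ∈ Finset.HasAntidiagonal.antidiagonal k,
        (((p.1 : ℂ) + 2 * p.2 - 2 * l₂) * imageCoeff l₁ l₂ x p.1 p.2) •
          tensorBasis l₁ l₂ (p.1 + 1, p.2) -
      ∑ p ∈ Finset.HasAntidiagonal.antidiagonal k,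
        ((x + l₁ - l₂ + p.2) * imageCoeff l₁ l₂ x p.1 p.2) •
          tensorBasis l₁ l₂ (p.1, p.2 + 1) := by
    rw [imageNum, map_sum, map_sum, Finset.smul_sum, ← Finset.sum_add_distrib,
      ← Finset.sum_neg_distrib, ← Finset.sum_sub_distrib]
    refine Finset.sum_congr rfl fun p hp => ?_
    obtain ⟨i, j⟩ := p
    obtain rfl : i + j = k := Finset.HasAntidiagonal.mem_antidiagonal.1 hp
    rw [map_smul, map_smul, diag_f_basis, lowerJOp_basis]
    push_cast
    module
  -- The vectors `(i + 1, j)` and `(i, j + 1)` overlap, so coefficients cannot be compared termwise.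
  -- The excess on the second kind is zero at `i = 0` and otherwise shifts onto the first kind.
  have h₄ : ∑ p ∈ Finset.HasAntidiagonal.antidiagonal k,
      (((p.2 : ℂ) + 1) * imageCoeff l₁ l₂ x p.1 (p.2 + 1) -
        (x + l₁ - l₂ + p.2) * imageCoeff l₁ l₂ x p.1 p.2) •
          tensorBasis l₁ l₂ (p.1, p.2 + 1) =
      ∑ p ∈ Finset.HasAntidiagonal.antidiagonal k,
        ((p.2 : ℂ) * imageCoeff l₁ l₂ x p.1 p.2) • tensorBasis l₁ l₂ (p.1 + 1, p.2) := by
    rcases k with _ | k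
    · have := imageCoeff_succ_zero_right l₁ l₂ x 0
      simp at this
      simp [this]
    · rw [Finset.Nat.sum_antidiagonal_succ, Finset.Nat.sum_antidiagonal_succ']
      simp only [imageCoeff_succ_zero_right, sub_self, zero_smul, Nat.cast_zero,
        zero_mul, zero_add]
      refine Finset.sum_congr rfl fun p _ => ?_
      rw [imageCoeff_succ_succ]
      push_cast
      rfl
  rw [h₁, h₃, Finset.sum_add_distrib]
  simp only [sub_smul, Finset.sum_sub_distrib] at h₄
  rw [sub_eq_iff_eq_add.1 h₄, ← add_assoc, ← Finset.sum_add_distrib, neg_add, ← sub_eq_add_neg]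
  congr 2
  refine Finset.sum_congr rfl fun p hp => ?_
  obtain ⟨i, j⟩ := p
  rw [imageCoeff_succ_left]
  module

/-- The product of the first `k` denominators of the `R`-matrix. -/
def denom (k : ℕ) : ℂ := ∏ s ∈ Finset.range k, (x - l₁ - l₂ + s)

variable {l₁ l₂ x} in
theorem denom_ne_zero (hx : OffPoles x l₁ l₂) (k : ℕ) : denom l₁ l₂ x k ≠ 0 :=
  Finset.prod_ne_zero_iff.2 fun s _ => hx s

/-- The image of `v ⊗ f ^ k w` under the `R`-matrix. -/
def image (k : ℕ) : Verma l₁ ⊗[ℂ] Verma l₂ :=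
  -- If the denominator vanishes, the scalar is `0` by the convention for division.
  ((k.factorial : ℂ) / denom l₁ l₂ x k) • imageNum l₁ l₂ x k

/-- The image of `f ^ i v ⊗ f ^ j w` under the `R`-matrix. -/
def imageBasis : ℕ → ℕ → Verma l₁ ⊗[ℂ] Verma l₂
  | 0, j => image l₁ l₂ x j
  | i + 1, j => diag _ _ f (imageBasis i j) - imageBasis i (j + 1)

/-- The `R`-matrix of two Verma modules. -/
def vermaR : Module.End ℂ (Verma l₁ ⊗[ℂ] Verma l₂) :=
  (tensorBasis l₁ l₂).constr ℂ fun p => imageBasis l₁ l₂ x p.1 p.2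

theorem vermaR_basis (i j : ℕ) :
    vermaR l₁ l₂ x (tensorBasis l₁ l₂ (i, j)) = imageBasis l₁ l₂ x i j := by
  rw [vermaR, Module.Basis.constr_basis]

theorem vermaR_top :
    vermaR l₁ l₂ x (vermaTop l₁ ⊗ₜ vermaTop l₂) = vermaTop l₁ ⊗ₜ vermaTop l₂ := by
  have : vermaTop l₁ ⊗ₜ vermaTop l₂ = tensorBasis l₁ l₂ (0, 0) := (tensorBasis_apply _ _ _ _).symm
  rw [this, vermaR_basis, imageBasis, image, imageNum_zero]
  simp [denom]

/-- The recursive clause of `imageBasis` is this identity solved for the image of `f ^ (i+1) v ⊗ f ^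
j w`, so it holds at the poles as well. -/
theorem vermaR_diag_f (t : Verma l₁ ⊗[ℂ] Verma l₂) :
    vermaR l₁ l₂ x (diag _ _ f t) = diag _ _ f (vermaR l₁ l₂ x t) := by
  suffices H : vermaR l₁ l₂ x ∘ₗ diag _ _ f = diag _ _ f ∘ₗ vermaR l₁ l₂ x from
    LinearMap.congr_fun H t
  apply (tensorBasis l₁ l₂).ext
  rintro ⟨i, j⟩
  simp only [LinearMap.comp_apply, diag_f_basis, map_add, vermaR_basis]
  rw [imageBasis, sub_add_cancel]

theorem diag_h_image (k : ℕ) : diag _ _ h (image l₁ l₂ x k) =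
    (l₁ + l₂ - k) • image l₁ l₂ x k := by
  rw [image, map_smul, diag_h_imageNum, smul_comm]

theorem vermaR_diag_h (t : Verma l₁ ⊗[ℂ] Verma l₂) :
    vermaR l₁ l₂ x (diag _ _ h t) = diag _ _ h (vermaR l₁ l₂ x t) := by
  suffices H : vermaR l₁ l₂ x ∘ₗ diag _ _ h - diag _ _ h ∘ₗ vermaR l₁ l₂ x = 0 from
    sub_eq_zero.1 (LinearMap.congr_fun H t)
  refine eq_zero_of_diag_f _ (fun k => ?_) fun t ht => ?_
  · simp only [LinearMap.sub_apply, LinearMap.comp_apply, diag_h_basis, map_smul, vermaR_basis,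
      imageBasis, diag_h_image, Nat.cast_zero, sub_zero, sub_self]
  · simp only [LinearMap.sub_apply, LinearMap.comp_apply, sub_eq_zero, diag_h_diag_f,
      map_sub, vermaR_diag_f] at ht ⊢
    rw [ht]

variable {l₁ l₂ x}

theorem diag_e_image (hx : OffPoles x l₁ l₂) (k : ℕ) : diag _ _ e (image l₁ l₂ x (k + 1)) =
    (((k : ℂ) + 1) * (2 * l₂ - k)) • image l₁ l₂ x k := by
  have h₁ := denom_ne_zero hx k
  have h₂ := hx k
  have h₃ : denom l₁ l₂ x (k + 1) = denom l₁ l₂ x k * (x - l₁ - l₂ + k) :=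
    Finset.prod_range_succ _ _
  rw [image, image, map_smul, diag_e_imageNum, smul_smul, smul_smul, h₃, Nat.factorial_succ]
  congr 1
  push_cast
  field_simp

theorem lowerJOp_image (hx : OffPoles x l₁ l₂) (k : ℕ) :
    lowerJOp _ _ x (image l₁ l₂ x k) = -((x - l₁ - l₂ + k) • image l₁ l₂ x (k + 1)) -
      (l₂ - k) • diag _ _ f (image l₁ l₂ x k) := by
  have h₁ := denom_ne_zero hx k
  have h₂ := hx k
  have h₃ : denom l₁ l₂ x (k + 1) = denom l₁ l₂ x k * (x - l₁ - l₂ + k) :=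
    Finset.prod_range_succ _ _
  have h₄ : (x - l₁ - l₂ + k) * (((k + 1).factorial : ℂ) / denom l₁ l₂ x (k + 1)) =
      ((k.factorial : ℂ) / denom l₁ l₂ x k) * (k + 1) := by
    rw [h₃, Nat.factorial_succ]
    push_cast
    field_simp
  rw [eq_sub_iff_add_eq', image, image, map_smul, map_smul, smul_comm (l₂ - (k : ℂ)), ← smul_add,
    lowerJOp_imageNum, smul_smul, h₄, smul_neg, smul_smul]

/-- Because `[e, f] = 2h` and `vermaR` commutes with `f` and `h`, the kernel of its commutator with
`e` is `f`-stable. Only the vectors `v ⊗ f ^ k w` remain to be checked. -/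
theorem vermaR_diag_e (hx : OffPoles x l₁ l₂) (t : Verma l₁ ⊗[ℂ] Verma l₂) :
    vermaR l₁ l₂ x (diag _ _ e t) = diag _ _ e (vermaR l₁ l₂ x t) := by
  suffices H : vermaR l₁ l₂ x ∘ₗ diag _ _ e - diag _ _ e ∘ₗ vermaR l₁ l₂ x = 0 from
    sub_eq_zero.1 (LinearMap.congr_fun H t)
  refine eq_zero_of_diag_f _ (fun k => ?_) fun t ht => ?_
  · rw [LinearMap.sub_apply, LinearMap.comp_apply, LinearMap.comp_apply, diag_e_basis, sub_eq_zero]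
    rcases k with _ | k
    · have : diag (Verma l₁) (Verma l₂) e (tensorBasis l₁ l₂ (0, 0)) = 0 := by
        simp [diag_e_basis]
      simp only [vermaR_basis, imageBasis, image, imageNum_zero, map_smul, this]
      simp
    · simp only [vermaR_basis, map_smul, imageBasis, diag_e_image hx,
        Nat.add_sub_cancel, Nat.cast_zero, zero_mul, zero_smul, zero_add]
      push_cast
      module
  · simp only [LinearMap.sub_apply, LinearMap.comp_apply, sub_eq_zero, diag_e_diag_f,
      map_add, map_smul, vermaR_diag_f, vermaR_diag_h] at ht ⊢
    rw [ht]

theorem vermaR_lowerJ (hx : OffPoles x l₁ l₂) (t : Verma l₁ ⊗[ℂ] Verma l₂) :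
    vermaR l₁ l₂ x (lowerJ _ _ x t) = lowerJOp _ _ x (vermaR l₁ l₂ x t) := by
  suffices H : vermaR l₁ l₂ x ∘ₗ lowerJ _ _ x - lowerJOp _ _ x ∘ₗ vermaR l₁ l₂ x = 0 from
    sub_eq_zero.1 (LinearMap.congr_fun H t)
  refine eq_zero_of_diag_f _ (fun k => ?_) fun t ht => ?_
  · simp only [LinearMap.sub_apply, LinearMap.comp_apply, lowerJ_basis, map_sub, map_smul,
      vermaR_basis]
    simp only [imageBasis, lowerJOp_image hx]
    push_cast
    module
  · simp only [LinearMap.sub_apply, LinearMap.comp_apply, sub_eq_zero, ← diag_f_lowerJ,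
      vermaR_diag_f] at ht ⊢
    rw [ht, diag_f_lowerJOp]

theorem isNormalizedIntertwiner_vermaR (hx : OffPoles x l₁ l₂) :
    IsNormalizedIntertwiner (vermaTop l₁) (vermaTop l₂) x (vermaR l₁ l₂ x) :=
  (isNormalizedIntertwiner_iff _ _ _ _).2
    ⟨vermaR_diag_e hx, vermaR_diag_f l₁ l₂ x, vermaR_lowerJ hx, vermaR_top l₁ l₂ x⟩

/-- Two intertwiners out of `V ⊗ V` agree if they agree on the highest weight vector. -/
theorem eq_of_intertwines (hx : OffPoles x l₁ l₂) {Z : Type*} [AddCommGroup Z] [Module ℂ Z]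
    (F G : Module.End ℂ Z) (T T' : Verma l₁ ⊗[ℂ] Verma l₂ →ₗ[ℂ] Z)
    (h₀ : T (vermaTop l₁ ⊗ₜ vermaTop l₂) = T' (vermaTop l₁ ⊗ₜ vermaTop l₂))
    (hf : ∀ t, T (diag _ _ f t) = F (T t)) (hf' : ∀ t, T' (diag _ _ f t) = F (T' t))
    (hJ : ∀ t, T (lowerJ _ _ x t) = G (T t)) (hJ' : ∀ t, T' (lowerJ _ _ x t) = G (T' t)) :
    T = T' := by
  rw [← sub_eq_zero]
  apply eq_zero_of_lowering hx
  · rw [LinearMap.sub_apply, h₀, sub_self]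
  · intro t ht
    rw [LinearMap.sub_apply, sub_eq_zero] at ht ⊢
    rw [hf, hf', ht]
  · intro t ht
    rw [LinearMap.sub_apply, sub_eq_zero] at ht ⊢
    rw [hJ, hJ', ht]

theorem isRationalRMatrix_vermaR (hx : OffPoles x l₁ l₂) :
    IsRationalRMatrix (vermaTop l₁) (vermaTop l₂) x (vermaR l₁ l₂ x) := by
  refine ⟨isNormalizedIntertwiner_vermaR hx, fun R' hR' => ?_⟩
  obtain ⟨-, hf, hJ, hn⟩ := (isNormalizedIntertwiner_iff _ _ _ _).1 hR'
  exact eq_of_intertwines hx _ _ _ _ (hn.trans (vermaR_top l₁ l₂ x).symm) hf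
    (vermaR_diag_f l₁ l₂ x) hJ (vermaR_lowerJ hx)

theorem OffPoles.symm (hx : OffPoles x l₁ l₂) : OffPoles x l₂ l₁ := fun s => by
  have := hx s
  rwa [sub_right_comm] at this

/-- The symmetry of the `R`-matrix under the permutation of the factors. -/
theorem comm_vermaR (hx : OffPoles x l₁ l₂) (t : Verma l₁ ⊗[ℂ] Verma l₂) :
    TensorProduct.comm ℂ _ _ (vermaR l₁ l₂ x t) =
      vermaR l₂ l₁ x (TensorProduct.comm ℂ _ _ t) := by
  have hc : ∀ s : Verma l₂ ⊗[ℂ] Verma l₁, TensorProduct.comm ℂ _ _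
      (TensorProduct.comm ℂ (Verma l₂) (Verma l₁) s) = s :=
    (TensorProduct.comm ℂ (Verma l₂) (Verma l₁)).symm_apply_apply
  have H : vermaR l₁ l₂ x = (TensorProduct.comm ℂ _ _).toLinearMap ∘ₗ vermaR l₂ l₁ x ∘ₗ
      (TensorProduct.comm ℂ _ _).toLinearMap := by
    -- The conjugate by the permutation satisfies the same commutation rules and fixes the top
    -- vector, so uniqueness identifies the two.
    refine eq_of_intertwines hx _ _ _ _ ?_ (vermaR_diag_f l₁ l₂ x) ?_ (vermaR_lowerJ hx) ?_
    · simp only [LinearMap.comp_apply, LinearEquiv.coe_coe, TensorProduct.comm_tmul, vermaR_top]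
    · intro t
      simp only [LinearMap.comp_apply, LinearEquiv.coe_coe, comm_diag, vermaR_diag_f]
    · intro t
      simp only [LinearMap.comp_apply, LinearEquiv.coe_coe, comm_lowerJ, map_sub, map_neg,
        map_smul, vermaR_lowerJ hx.symm, vermaR_diag_f, comm_lowerJOp, comm_diag]
      module
  rw [H]
  simp only [LinearMap.comp_apply, LinearEquiv.coe_coe, hc]

end Construction

/-! ### Descent to the irreducible quotients -/

section Descent

variable {l₁ l₂ x : ℂ}

/-- `V ⊗ S` as a subspace of `V ⊗ V`. -/
def tensorSRight (l₁ l₂ : ℂ) : Submodule ℂ (Verma l₁ ⊗[ℂ] Verma l₂) :=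
  LinearMap.range (TensorProduct.map (LinearMap.id : Verma l₁ →ₗ[ℂ] Verma l₁)
    (vermaS l₂ : Submodule ℂ (Verma l₂)).subtype)

/-- `S ⊗ V` as a subspace of `V ⊗ V`. -/
def tensorSLeft (l₁ l₂ : ℂ) : Submodule ℂ (Verma l₁ ⊗[ℂ] Verma l₂) :=
  LinearMap.range (TensorProduct.map (vermaS l₁ : Submodule ℂ (Verma l₁)).subtype
    (LinearMap.id : Verma l₂ →ₗ[ℂ] Verma l₂))

theorem tensorS_eq (l₁ l₂ : ℂ) : tensorS l₁ l₂ = tensorSLeft l₁ l₂ ⊔ tensorSRight l₁ l₂ := rfl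

theorem vermaBasis_mem_vermaS {lam : ℂ} {n i : ℕ} (hn : 2 * lam = n) (hi : n + 1 ≤ i) :
    vermaBasis lam i ∈ (vermaS lam : Submodule ℂ (Verma lam)) :=
  Submodule.subset_span ⟨n, i, hn, hi, rfl⟩

theorem tmul_mem_tensorSRight (m : Verma l₁) {s : Verma l₂}
    (hs : s ∈ (vermaS l₂ : Submodule ℂ (Verma l₂))) : m ⊗ₜ s ∈ tensorSRight l₁ l₂ :=
  ⟨m ⊗ₜ ⟨s, hs⟩, rfl⟩

theorem basis_induction {ι M : Type*} [AddCommGroup M] [Module ℂ M] (b : Module.Basis ι ℂ M)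
    {P : M → Prop} (zero : P 0) (add : ∀ m n, P m → P n → P (m + n))
    (smul : ∀ (c : ℂ) m, P m → P (c • m)) (basis : ∀ i, P (b i)) (m : M) : P m := by
  induction b.mem_span m using Submodule.span_induction with
  | mem _ hm => obtain ⟨i, rfl⟩ := hm; exact basis i
  | zero => exact zero
  | add m n _ _ hm hn => exact add m n hm hn
  | smul c m _ hm => exact smul c m hm

/-- `V ⊗ S` is spanned by basis vectors. -/
theorem tensorSRight_le {W : Submodule ℂ (Verma l₁ ⊗[ℂ] Verma l₂)}
    (hW : ∀ n i j : ℕ, 2 * l₂ = n → n + 1 ≤ j → tensorBasis l₁ l₂ (i, j) ∈ W) :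
    tensorSRight l₁ l₂ ≤ W := by
  rintro _ ⟨t, rfl⟩
  induction t using TensorProduct.induction_on with
  | zero => simp
  | add s t hs ht => rw [map_add]; exact W.add_mem hs ht
  | tmul m s =>
    obtain ⟨s, hs⟩ := s
    change m ⊗ₜ s ∈ W
    change s ∈ Submodule.span ℂ _ at hs
    induction hs using Submodule.span_induction with
    | mem w hw =>
      obtain ⟨n, j, hn, hj, rfl⟩ := hw
      induction m using basis_induction (vermaBasis l₁) with
      | zero => simp
      | add a b ha hb => rw [TensorProduct.add_tmul]; exact W.add_mem ha hb
      | smul c a ha => rw [← TensorProduct.smul_tmul']; exact W.smul_mem _ ha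
      | basis i => rw [← tensorBasis_apply]; exact hW n i j hn hj
    | zero => simp
    | add a b _ _ ha hb => rw [TensorProduct.tmul_add]; exact W.add_mem ha hb
    | smul c a _ ha => rw [TensorProduct.tmul_smul]; exact W.smul_mem _ ha

theorem diag_mem_tensorSRight (a : Sl2) {t : Verma l₁ ⊗[ℂ] Verma l₂}
    (ht : t ∈ tensorSRight l₁ l₂) : diag _ _ a t ∈ tensorSRight l₁ l₂ := by
  obtain ⟨t, rfl⟩ := ht
  induction t using TensorProduct.induction_on with
  | zero => simp
  | add s t hs ht => rw [map_add, map_add]; exact add_mem hs ht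
  | tmul m s =>
    rw [TensorProduct.map_tmul, diag_tmul]
    exact add_mem (tmul_mem_tensorSRight _ s.2)
      (tmul_mem_tensorSRight _ ((vermaS l₂).lie_mem s.2))

/-- The factor of index `n - j` in the first product is `n - 2 l₂ = 0`. Thus for `k > n` the image
of `v ⊗ f ^ k w` has no component outside `V ⊗ S`. -/
theorem imageCoeff_eq_zero {n i j : ℕ} (hn : 2 * l₂ = n) (hj : j ≤ n) (hij : n + 1 ≤ i + j) :
    imageCoeff l₁ l₂ x i j = 0 := by
  have : ∏ l ∈ Finset.range i, ((j : ℂ) + l - 2 * l₂) = 0 := by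
    refine Finset.prod_eq_zero (Finset.mem_range.2 (by omega : n - j < i)) ?_
    rw [hn, Nat.cast_sub hj]
    ring
  rw [imageCoeff, this, zero_mul, zero_div]

theorem imageBasis_mem_tensorSRight {n : ℕ} (hn : 2 * l₂ = n) (i j : ℕ) (hj : n + 1 ≤ j) :
    imageBasis l₁ l₂ x i j ∈ tensorSRight l₁ l₂ := by
  induction i generalizing j with
  | zero =>
    refine Submodule.smul_mem _ _ (Submodule.sum_mem _ fun p hp => ?_)
    obtain ⟨i, k⟩ := p
    obtain rfl : i + k = j := Finset.HasAntidiagonal.mem_antidiagonal.1 hp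
    rcases Nat.lt_or_ge n k with hk | hk
    · rw [tensorBasis_apply]
      exact Submodule.smul_mem _ _ (tmul_mem_tensorSRight _ (vermaBasis_mem_vermaS hn hk))
    · rw [imageCoeff_eq_zero hn hk hj, zero_smul]
      exact zero_mem _
  | succ i ih => exact sub_mem (diag_mem_tensorSRight f (ih j hj)) (ih (j + 1) (by omega))

theorem vermaR_mem_tensorSRight {t : Verma l₁ ⊗[ℂ] Verma l₂} (ht : t ∈ tensorSRight l₁ l₂) :
    vermaR l₁ l₂ x t ∈ tensorSRight l₁ l₂ := by
  suffices H : tensorSRight l₁ l₂ ≤ (tensorSRight l₁ l₂).comap (vermaR l₁ l₂ x) from H ht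
  refine tensorSRight_le fun n i j hn hj => ?_
  rw [Submodule.mem_comap, vermaR_basis]
  exact imageBasis_mem_tensorSRight hn i j hj

theorem comm_mem_tensorSRight {t : Verma l₁ ⊗[ℂ] Verma l₂} (ht : t ∈ tensorSLeft l₁ l₂) :
    TensorProduct.comm ℂ _ _ t ∈ tensorSRight l₂ l₁ := by
  obtain ⟨t, rfl⟩ := ht
  exact ⟨TensorProduct.comm ℂ _ _ t, TensorProduct.map_comm _ _ _⟩

theorem comm_mem_tensorSLeft {t : Verma l₁ ⊗[ℂ] Verma l₂} (ht : t ∈ tensorSRight l₁ l₂) :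
    TensorProduct.comm ℂ _ _ t ∈ tensorSLeft l₂ l₁ := by
  obtain ⟨t, rfl⟩ := ht
  exact ⟨TensorProduct.comm ℂ _ _ t, TensorProduct.map_comm _ _ _⟩

/-- The explicit formula treats the factors asymmetrically and says little about `S ⊗ V`; the
symmetry `comm_vermaR` transfers the result from `V ⊗ S`. -/
theorem vermaR_mem_tensorSLeft (hx : OffPoles x l₁ l₂) {t : Verma l₁ ⊗[ℂ] Verma l₂}
    (ht : t ∈ tensorSLeft l₁ l₂) : vermaR l₁ l₂ x t ∈ tensorSLeft l₁ l₂ := by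
  have h₁ := comm_mem_tensorSLeft
    (vermaR_mem_tensorSRight (x := x) (comm_mem_tensorSRight ht))
  rw [comm_vermaR hx.symm] at h₁
  have h₂ : TensorProduct.comm ℂ _ _ (TensorProduct.comm ℂ (Verma l₁) (Verma l₂) t) = t :=
    (TensorProduct.comm ℂ (Verma l₁) (Verma l₂)).symm_apply_apply t
  rwa [h₂] at h₁

theorem vermaR_mem_tensorS (hx : OffPoles x l₁ l₂) {t : Verma l₁ ⊗[ℂ] Verma l₂}
    (ht : t ∈ tensorS l₁ l₂) : vermaR l₁ l₂ x t ∈ tensorS l₁ l₂ := by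
  rw [tensorS_eq] at ht ⊢
  obtain ⟨a, ha, b, hb, rfl⟩ := Submodule.mem_sup.1 ht
  rw [map_add]
  exact add_mem (Submodule.mem_sup_left (vermaR_mem_tensorSLeft hx ha))
    (Submodule.mem_sup_right (vermaR_mem_tensorSRight hb))

theorem toIrr_surjective (lam : ℂ) : Function.Surjective (toIrr lam) :=
  Submodule.Quotient.mk_surjective _

theorem exact_subtype_toIrr (lam : ℂ) :
    Function.Exact (vermaS lam : Submodule ℂ (Verma lam)).subtype (toIrr lam) := by
  intro v
  have : v ∈ Set.range (vermaS lam : Submodule ℂ (Verma lam)).subtype ↔ v ∈ vermaS lam := by simp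
  rw [this]
  exact LieSubmodule.Quotient.mk_eq_zero (N := vermaS lam)

/-- Right exactness of the tensor product. -/
theorem ker_map_toIrr (l₁ l₂ : ℂ) :
    LinearMap.ker (TensorProduct.map (toIrr l₁) (toIrr l₂)) = tensorS l₁ l₂ := by
  rw [TensorProduct.map_ker (exact_subtype_toIrr l₁) (toIrr_surjective l₁)
    (exact_subtype_toIrr l₂) (toIrr_surjective l₂), sup_comm]
  rfl

/-- The `R`-matrix descends to the irreducible quotients. -/
theorem exists_isRationalRMatrix_irr (hx : OffPoles x l₁ l₂) :
    ∃ Rbar : Module.End ℂ (Irr l₁ ⊗[ℂ] Irr l₂),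
      (∀ t : Verma l₁ ⊗[ℂ] Verma l₂,
        TensorProduct.map (toIrr l₁) (toIrr l₂) (vermaR l₁ l₂ x t) =
          Rbar (TensorProduct.map (toIrr l₁) (toIrr l₂) t)) ∧
      IsRationalRMatrix (irrTop l₁) (irrTop l₂) x Rbar := by
  set π := TensorProduct.map (toIrr l₁) (toIrr l₂) with hπ
  have hsurj : Function.Surjective π :=
    TensorProduct.map_surjective (toIrr_surjective l₁) (toIrr_surjective l₂)
  have hdiag : ∀ a t, π (diag _ _ a t) = diag _ _ a (π t) :=
    map_diag (LieSubmodule.Quotient.mk' (vermaS l₁)) (LieSubmodule.Quotient.mk' (vermaS l₂))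
  have hJ : ∀ t, π (lowerJ _ _ x t) = lowerJ _ _ x (π t) :=
    map_lowerJ (LieSubmodule.Quotient.mk' (vermaS l₁)) (LieSubmodule.Quotient.mk' (vermaS l₂)) x
  have hJ' : ∀ t, π (lowerJOp _ _ x t) = lowerJOp _ _ x (π t) :=
    map_lowerJOp (LieSubmodule.Quotient.mk' (vermaS l₁)) (LieSubmodule.Quotient.mk' (vermaS l₂)) x
  have htop : π (vermaTop l₁ ⊗ₜ vermaTop l₂) = irrTop l₁ ⊗ₜ irrTop l₂ := rfl
  have hker : LinearMap.ker π ≤ LinearMap.ker (π ∘ₗ vermaR l₁ l₂ x) := by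
    intro t ht
    rw [hπ, ker_map_toIrr] at ht
    have := vermaR_mem_tensorS hx ht
    rwa [← ker_map_toIrr] at this
  let Rbar : Module.End ℂ (Irr l₁ ⊗[ℂ] Irr l₂) :=
    (LinearMap.ker π).liftQ (π ∘ₗ vermaR l₁ l₂ x) hker ∘ₗ
      (π.quotKerEquivOfSurjective hsurj).symm.toLinearMap
  have hR : ∀ t, π (vermaR l₁ l₂ x t) = Rbar (π t) := by
    intro t
    have : (π.quotKerEquivOfSurjective hsurj).symm (π t) = Submodule.Quotient.mk t := by
      rw [LinearEquiv.symm_apply_eq]; rfl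
    simp only [Rbar, LinearMap.comp_apply, LinearEquiv.coe_coe, this]
    rfl
  refine ⟨Rbar, hR, (isNormalizedIntertwiner_iff _ _ _ _).2 ⟨?_, ?_, ?_, ?_⟩, fun R' hR' => ?_⟩
  · intro t
    obtain ⟨t, rfl⟩ := hsurj t
    rw [← hdiag, ← hR, vermaR_diag_e hx, hdiag, hR]
  · intro t
    obtain ⟨t, rfl⟩ := hsurj t
    rw [← hdiag, ← hR, vermaR_diag_f, hdiag, hR]
  · intro t
    obtain ⟨t, rfl⟩ := hsurj t
    rw [← hJ, ← hR, vermaR_lowerJ hx, hJ', hR]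
  · rw [← htop, ← hR, vermaR_top]
  · obtain ⟨-, hf, hJR, hn⟩ := (isNormalizedIntertwiner_iff _ _ _ _).1 hR'
    -- Uniqueness is pulled back to `V ⊗ V`, where cyclicity is known: both composites intertwine
    -- the same lowering operators and agree on the top vector.
    have H : R' ∘ₗ π = π ∘ₗ vermaR l₁ l₂ x := by
      refine eq_of_intertwines hx (diag _ _ f) (lowerJOp _ _ x) _ _ ?_ ?_ ?_ ?_ ?_
      · rw [LinearMap.comp_apply, LinearMap.comp_apply, htop, hn, vermaR_top, htop]
      · intro t
        rw [LinearMap.comp_apply, LinearMap.comp_apply, hdiag, hf]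
      · intro t
        rw [LinearMap.comp_apply, LinearMap.comp_apply, vermaR_diag_f, hdiag]
      · intro t
        rw [LinearMap.comp_apply, LinearMap.comp_apply, hJ, hJR]
      · intro t
        rw [LinearMap.comp_apply, LinearMap.comp_apply, vermaR_lowerJ hx, hJ']
    apply LinearMap.ext
    intro t
    obtain ⟨t, rfl⟩ := hsurj t
    rw [← hR]
    exact LinearMap.congr_fun H t

end Descent

/-! ### Dependence on the parameters -/

section Meromorphy

/-- The functions of `(x, lam₁, lam₂)` that are, off the poles, the quotient of a holomorphic
function by a product of finitely many linear forms vanishing on the poles. -/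
def HasDenom (F : ℂ × ℂ × ℂ → ℂ) : Prop :=
  ∃ (N : ℕ) (G : ℂ × ℂ × ℂ → ℂ), (∀ p, AnalyticAt ℂ G p) ∧
    ∀ p : ℂ × ℂ × ℂ, denom p.2.1 p.2.2 p.1 N ≠ 0 → F p = G p / denom p.2.1 p.2.2 p.1 N

theorem analyticAt_snd_fst (p : ℂ × ℂ × ℂ) : AnalyticAt ℂ (fun q : ℂ × ℂ × ℂ => q.2.1) p :=
  analyticAt_fst.comp analyticAt_snd

theorem analyticAt_snd_snd (p : ℂ × ℂ × ℂ) : AnalyticAt ℂ (fun q : ℂ × ℂ × ℂ => q.2.2) p :=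
  analyticAt_snd.comp analyticAt_snd

theorem analyticAt_denom_factor (s : ℕ) (p : ℂ × ℂ × ℂ) :
    AnalyticAt ℂ (fun q : ℂ × ℂ × ℂ => q.1 - q.2.1 - q.2.2 + (s : ℂ)) p :=
  ((analyticAt_fst.sub (analyticAt_snd_fst p)).sub (analyticAt_snd_snd p)).add analyticAt_const

theorem analyticAt_denom (N : ℕ) (p : ℂ × ℂ × ℂ) :
    AnalyticAt ℂ (fun q : ℂ × ℂ × ℂ => denom q.2.1 q.2.2 q.1 N) p :=
  Finset.analyticAt_fun_prod _ fun s _ => analyticAt_denom_factor s p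

theorem analyticAt_imageCoeff (i j : ℕ) (p : ℂ × ℂ × ℂ) :
    AnalyticAt ℂ (fun q : ℂ × ℂ × ℂ => imageCoeff q.2.1 q.2.2 q.1 i j) p := by
  simp only [imageCoeff, div_eq_mul_inv]
  refine ((Finset.analyticAt_fun_prod _ fun l _ => ?_).mul
    (Finset.analyticAt_fun_prod _ fun l _ => ?_)).mul analyticAt_const
  · exact analyticAt_const.sub (analyticAt_const.mul (analyticAt_snd_snd p))
  · exact ((analyticAt_fst.add (analyticAt_snd_fst p)).sub (analyticAt_snd_snd p)).add
      analyticAt_const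

theorem HasDenom.of_analyticAt {F : ℂ × ℂ × ℂ → ℂ} (hF : ∀ p, AnalyticAt ℂ F p) : HasDenom F :=
  ⟨0, F, hF, fun p _ => by simp [denom]⟩

theorem denom_mul_tail (l₁ l₂ x : ℂ) {N M : ℕ} (h : N ≤ M) :
    denom l₁ l₂ x N * ∏ s ∈ Finset.Ico N M, (x - l₁ - l₂ + s) = denom l₁ l₂ x M :=
  Finset.prod_range_mul_prod_Ico _ h

/-- The denominators are initial segments of one product, so the longer one is a common denominator.
-/
theorem HasDenom.sub {F F' : ℂ × ℂ × ℂ → ℂ} (hF : HasDenom F) (hF' : HasDenom F') :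
    HasDenom fun p => F p - F' p := by
  obtain ⟨N, G, hG, hN⟩ := hF
  obtain ⟨N', G', hG', hN'⟩ := hF'
  refine ⟨max N N', fun p =>
    G p * ∏ s ∈ Finset.Ico N (max N N'), (p.1 - p.2.1 - p.2.2 + s) -
      G' p * ∏ s ∈ Finset.Ico N' (max N N'), (p.1 - p.2.1 - p.2.2 + s), fun p => ?_, fun p hp => ?_⟩
  · exact ((hG p).mul (Finset.analyticAt_fun_prod _ fun s _ => analyticAt_denom_factor s p)).sub
      ((hG' p).mul (Finset.analyticAt_fun_prod _ fun s _ => analyticAt_denom_factor s p))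
  · have h₁ := denom_mul_tail p.2.1 p.2.2 p.1 (le_max_left N N')
    have h₂ := denom_mul_tail p.2.1 p.2.2 p.1 (le_max_right N N')
    have h₃ := hp
    rw [← h₁] at h₃
    have h₄ := hp
    rw [← h₂] at h₄
    beta_reduce
    rw [hN p (left_ne_zero_of_mul h₃), hN' p (left_ne_zero_of_mul h₄), sub_div]
    congr 1
    · rw [← h₁, mul_div_mul_right _ _ (right_ne_zero_of_mul h₃)]
    · rw [← h₂, mul_div_mul_right _ _ (right_ne_zero_of_mul h₄)]

theorem HasDenom.add {F F' : ℂ × ℂ × ℂ → ℂ} (hF : HasDenom F) (hF' : HasDenom F') :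
    HasDenom fun p => F p + F' p := by
  have h₀ : HasDenom fun _ => (0 : ℂ) := .of_analyticAt fun _ => analyticAt_const
  simpa using hF.sub (h₀.sub hF')

/-- On the line where only `x` varies, the denominator has finitely many zeros, while every
neighbourhood in `ℂ` is infinite. -/
theorem not_eventually_denom_eq_zero (N : ℕ) (p : ℂ × ℂ × ℂ) :
    ¬ ∀ᶠ q in nhds p, denom q.2.1 q.2.2 q.1 N = 0 := by
  intro H
  have hc : Filter.Tendsto (fun t : ℂ => (t, p.2)) (nhds p.1) (nhds p) := by
    have : Continuous fun t : ℂ => (t, p.2) := by fun_prop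
    exact this.tendsto p.1
  have h₁ : ∀ᶠ t in nhds p.1, denom p.2.1 p.2.2 t N = 0 := hc.eventually H
  have hfin : Set.Finite {t : ℂ | denom p.2.1 p.2.2 t N = 0} := by
    refine ((Finset.range N).finite_toSet.image fun s : ℕ => p.2.1 + p.2.2 - (s : ℂ)).subset ?_
    intro t ht
    obtain ⟨s, hs, h₀⟩ := Finset.prod_eq_zero_iff.1 (Set.mem_ofPred_eq ▸ ht)
    exact ⟨s, hs, by linear_combination -h₀⟩
  exact infinite_of_mem_nhds p.1 h₁ hfin

theorem HasDenom.isMeromorphic {F : ℂ × ℂ × ℂ → ℂ} (hF : HasDenom F) : IsMeromorphic F := by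
  obtain ⟨N, G, hG, hN⟩ := hF
  exact fun p => ⟨G, _, hG p, analyticAt_denom N p, not_eventually_denom_eq_zero N p,
    Filter.Eventually.of_forall hN⟩

/-- Only finitely many hyperplanes matter for a given `F`, so its denominator stays nonzero near the
point and the quotient formula holds on a neighbourhood. -/
theorem HasDenom.analyticAt {F : ℂ × ℂ × ℂ → ℂ} (hF : HasDenom F) {x l₁ l₂ : ℂ}
    (hx : OffPoles x l₁ l₂) : AnalyticAt ℂ F (x, l₁, l₂) := by
  obtain ⟨N, G, hG, hN⟩ := hF
  have h₀ := denom_ne_zero hx N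
  have hd := analyticAt_denom N (x, l₁, l₂)
  refine ((hG _).div hd h₀).congr ?_
  filter_upwards [hd.continuousAt.eventually_ne h₀] with q hq
  exact (hN q hq).symm

/-- The case distinctions discard the truncated predecessors of `0`. -/
theorem repr_diag_f (l₁ l₂ : ℂ) (t : Verma l₁ ⊗[ℂ] Verma l₂) (p : ℕ × ℕ) :
    (tensorBasis l₁ l₂).repr (diag _ _ f t) p =
      (if p.1 = 0 then 0 else (tensorBasis l₁ l₂).repr t (p.1 - 1, p.2)) +
        (if p.2 = 0 then 0 else (tensorBasis l₁ l₂).repr t (p.1, p.2 - 1)) := by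
  induction t using basis_induction (tensorBasis l₁ l₂) with
  | zero => simp
  | add a b ha hb =>
    rw [map_add, map_add, Finsupp.add_apply, ha, hb, map_add]
    simp only [Finsupp.add_apply]
    split_ifs <;> ring
  | smul c a ha =>
    rw [map_smul, map_smul, Finsupp.smul_apply, ha, map_smul]
    simp only [Finsupp.smul_apply, smul_eq_mul]
    split_ifs <;> ring
  | basis q =>
    obtain ⟨i, j⟩ := q
    obtain ⟨a, b⟩ := p
    rw [diag_f_basis, map_add]
    simp only [Module.Basis.repr_self, Finsupp.add_apply, Finsupp.single_apply, Prod.mk.injEq]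
    rcases a with _ | a <;> rcases b with _ | b <;> simp

theorem repr_imageNum (l₁ l₂ x : ℂ) (k : ℕ) (p : ℕ × ℕ) :
    (tensorBasis l₁ l₂).repr (imageNum l₁ l₂ x k) p =
      if p.1 + p.2 = k then imageCoeff l₁ l₂ x p.1 p.2 else 0 := by
  rw [imageNum, map_sum, Finsupp.finsetSum_apply]
  simp [Finsupp.single_apply, Finset.HasAntidiagonal.mem_antidiagonal]

/-- The recursion in `i` only shifts indices, adds and subtracts; all division occurs in the base
case, where the denominator is explicit. -/
theorem hasDenom_repr_imageBasis (i j : ℕ) (p : ℕ × ℕ) : HasDenom fun q : ℂ × ℂ × ℂ =>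
    (tensorBasis q.2.1 q.2.2).repr (imageBasis q.2.1 q.2.2 q.1 i j) p := by
  induction i generalizing j p with
  | zero =>
    refine ⟨j, fun q => j.factorial *
      if p.1 + p.2 = j then imageCoeff q.2.1 q.2.2 q.1 p.1 p.2 else 0, fun q => ?_, fun q _ => ?_⟩
    · split_ifs
      · exact analyticAt_const.mul (analyticAt_imageCoeff _ _ _)
      · fun_prop
    · simp only [imageBasis, image, map_smul, Finsupp.smul_apply, repr_imageNum, smul_eq_mul,
        div_mul_eq_mul_div]
  | succ i ih =>
    have h₀ : HasDenom fun _ => (0 : ℂ) := .of_analyticAt fun _ => analyticAt_const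
    simp only [imageBasis, map_sub, Finsupp.sub_apply, repr_diag_f]
    refine HasDenom.sub (HasDenom.add ?_ ?_) (ih _ _)
    · split_ifs
      exacts [h₀, ih _ _]
    · split_ifs
      exacts [h₀, ih _ _]

theorem hasDenom_entry (i j : ℕ × ℕ) : HasDenom (entry vermaR i j) := by
  obtain ⟨a, b⟩ := j
  unfold entry
  simp only [vermaR_basis]
  exact hasDenom_repr_imageBasis a b i

end Meromorphy

end RationalR

end

open RationalR in
theorem mainTheorem12 :
    ∃ R : ∀ lam₁ lam₂ : ℂ, ℂ → Module.End ℂ (Verma lam₁ ⊗[ℂ] Verma lam₂),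
      -- for irreducible Verma modules, `R lam₁ lam₂ x` is the rational `R`-matrix
      (∀ lam₁ lam₂ x : ℂ, ¬ IsDominant lam₁ → ¬ IsDominant lam₂ → OffPoles x lam₁ lam₂ →
        IsRationalRMatrix (vermaTop lam₁) (vermaTop lam₂) x (R lam₁ lam₂ x)) ∧
      -- it is meromorphic in `(x, lam₁, lam₂)`, and holomorphic off the listed hyperplanes
      (∀ i j : ℕ × ℕ, IsMeromorphic (entry R i j) ∧
        ∀ x lam₁ lam₂ : ℂ, OffPoles x lam₁ lam₂ →
          AnalyticAt ℂ (entry R i j) (x, lam₁, lam₂)) ∧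
      -- it preserves `S ⊗ V + V ⊗ S`
      (∀ lam₁ lam₂ x : ℂ, OffPoles x lam₁ lam₂ →
        ∀ t ∈ tensorS lam₁ lam₂, R lam₁ lam₂ x t ∈ tensorS lam₁ lam₂) ∧
      -- it descends to the rational `R`-matrix of the irreducible quotients
      (∀ lam₁ lam₂ x : ℂ, OffPoles x lam₁ lam₂ →
        ∃ Rbar : Module.End ℂ (Irr lam₁ ⊗[ℂ] Irr lam₂),
          (∀ t : Verma lam₁ ⊗[ℂ] Verma lam₂,
            TensorProduct.map (toIrr lam₁) (toIrr lam₂) (R lam₁ lam₂ x t) =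
              Rbar (TensorProduct.map (toIrr lam₁) (toIrr lam₂) t)) ∧
          IsRationalRMatrix (irrTop lam₁) (irrTop lam₂) x Rbar) := by
  exact ⟨vermaR, fun _ _ _ _ _ hx => isRationalRMatrix_vermaR hx,
    fun i j => ⟨(hasDenom_entry i j).isMeromorphic,
      fun _ _ _ hx => (hasDenom_entry i j).analyticAt hx⟩,
    fun _ _ _ hx _ ht => vermaR_mem_tensorS hx ht,
    fun _ _ _ hx => exists_isRationalRMatrix_irr hx⟩
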